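/- **Reference element.** Let $\Omega$ be the reference tetrahedron with the ordered vertices $v_1=0$, $v_2=\mathbf e_3$, $v_3=\mathbf e_2$, $v_4=\mathbf e_1$. For a tetrahedron with ordered vertices $P_1,\dots,P_4$ and a face $f_{ijk}$, $i<j<k$, the *normal vector* of the face is $(P_j-P_i)\times(P_k-P_i)$ (not normalised, oriented by the vertex order); on $\Omega$ it is denoted $\boldsymbol\nu_{ijk}$, so $\boldsymbol\nu_{123}=-\mathbf e_1$, $\boldsymbol\nu_{124}=\mathbf e_2$, $\boldsymbol\nu_{134}=-\mathbf e_3$, $\boldsymbol\nu_{234}=-(\mathbf e_1+\mathbf e_2+\mathbf e_3)$. **Scalar basis.** Let $p\ge 1$ and let $U^p$ be a family of linearly independent polynomials on $\Omega$, each associated with a polytope (vertex, edge, face or the cell) of $\Omega$: one for each vertex, $p-1$ for each edge, $\frac{(p-2)(p-1)}2$ for each face and $\frac{(p-3)(p-2)(p-1)}6$ for the cell, numbered on each polytope, such that a function associated with a polytope $S$ vanishes on every vertex, edge and face that does not contain $S$. **Template.** For each polytope $S$ let $\mathcal T_S$ be the following set of three vectors: $$\begin{aligned} \mathcal T_1&=\{-\mathbf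 e_1,\mathbf e_2,-\mathbf e_3\}, & \mathcal T_2&=\{\mathbf e_3-\mathbf e_1,\mathbf e_2-\mathbf e_3,-\mathbf e_3\}, & \mathcal T_3&=\{\mathbf e_2-\mathbf e_1,\mathbf e_2-\mathbf e_3,-\mathbf e_2\},\\ \mathcal T_4&=\{\mathbf e_2-\mathbf e_1,\mathbf e_1-\mathbf e_3,-\mathbf e_1\}, & \mathcal T_{12}&=\{-\mathbf e_1,\mathbf e_2,\mathbf e_3\}, & \mathcal T_{13}&=\{-\mathbf e_1,-\mathbf e_3,\mathbf e_2\},\\ \mathcal T_{14}&=\{\mathbf e_2,-\mathbf e_3,\mathbf e_1\}, & \mathcal T_{23}&=\{\mathbf e_3-\mathbf e_1,-\mathbf e_3,\mathbf e_2-\mathbf e_3\}, & \mathcal T_{24}&=\{\mathbf e_2-\mathbf e_3,-\mathbf e_3,\mathbf e_1-\mathbf e_3\},\\ \mathcal T_{34}&=\{\mathbf e_2-\mathbf e_3,-\mathbf e_2,\mathbf e_1-\mathbf e_2\}, & \mathcal T_{123}&=\{-\mathbf e_1,\mathbf e_3,\mathbf e_2\}, & \mathcal T_{124}&=\{\mathbf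 e_2,\mathbf e_3,\mathbf e_1\},\\ \mathcal T_{134}&=\{-\mathbf e_3,\mathbf e_2,\mathbf e_1\}, & \mathcal T_{234}&=\{-\mathbf e_3,\mathbf e_2-\mathbf e_3,\mathbf e_1-\mathbf e_3\}, & \mathcal T_{1234}&=\{\mathbf e_3,\mathbf e_2,\mathbf e_1\}. \end{aligned}$$ **$\mathcal{BDM}^p$ base functions.** These are the products $\boldsymbol\phi=n\boldsymbol\ell$ with $n\in U^p$ associated with $S$ and $\boldsymbol\ell\in\mathcal T_S$. Such a $\boldsymbol\phi$ is a *non-cell function of the face* $f\supseteq S$ if $\langle\boldsymbol\nu_f,\boldsymbol\ell\rangle\ne0$. It is a *cell function* if $S$ is an edge, a face or the cell, and $\langle\boldsymbol\nu_f,\boldsymbol\ell\rangle=0$ for every face $f\supseteq S$. **Grids.** A *grid* is a finite family of pairwise distinct nondegenerate tetrahedra $K$, each with an ordering of its vertices, such that two of them intersect exactly in the convex hull of their common vertices and order their common vertices in the same way. Its domain $V$ is the interior of the union of the closed tetrahedra. Let $\mathbf x_K$ be the affine map taking $v_1,\dots,v_4$ to the vertices of $K$ in order, with Jacobian $\boldsymbol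 J$. Scalar functions are mapped to $K$ by $n\mapsto n\circ\mathbf x_K^{-1}$ and vector fields by the contravariant Piola transformation $\boldsymbol\phi\mapsto(\frac1{\det\boldsymbol J}\boldsymbol J\boldsymbol\phi)\circ\mathbf x_K^{-1}$. * The *scalar space* of the grid is the span of the following functions, one for each vertex, edge, face and cell of the grid and each number $m$: on every element containing that polytope, the function equals the mapped $m$-th function of $U^p$ of the corresponding reference polytope; it is zero elsewhere. * The *$\mathcal{BDM}^p$ space* of the grid is the span of the mapped cell functions of each element (extended by zero) and, for each face $f$ of the grid, each polytope $s\subseteq f$ and each number $m$, of the field that equals, on every element having $f$ as a face, the mapped non-cell function of that face built from the $m$-th function of $U^p$ of the polytope $s$; the field is zero elsewhere. Here $H^1(V)$ and $H(\mathrm{div},V)$ are the spaces of $L^2$ functions with weak gradient, respectively $L^2$ vector fields with weak divergence, in $L^2$. **Theorem ($H(\mathrm{div},V)$-conformity).** 1. On every grid for which $U^p$ is $H^1$-conforming, i.e. whose scalar space is contained in $H^1(V)$, the $\mathcal{BDM}^p$ space is contained in $H(\mathrm{div},V)$. 2. On $\Omega$, every non-cell function $\boldsymbol\phi=n\boldsymbol\ell$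 of a face $f$ satisfies $\langle\boldsymbol\nu_f,\boldsymbol\phi\rangle=n$ on $f$, and its normal projection vanishes on the other three faces. The normal projections of every cell function vanish on all four faces. 3. The same holds for the Piola transformed functions on every nondegenerate tetrahedron with ordered vertices, with respect to its own normal vectors $(P_j-P_i)\times(P_k-P_i)$ and with $n\circ\mathbf x_K^{-1}$ in place of $n$. -/

import Mathlib

open MeasureTheory Set
open scoped ContDiff

noncomputable section

namespace PolytopalBDM

/-- Three-dimensional Euclidean space. -/
abbrev E3 : Type := EuclideanSpace ℝ (Fin 3)

/-! ### The Hilbert spaces, through weak derivatives -/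

/-- Test functions on `V`: smooth, with compact support contained in `V`. -/
def IsTestFunction (V : Set E3) (ψ : E3 → ℝ) : Prop :=
  ContDiff ℝ ∞ ψ ∧ HasCompactSupport ψ ∧ tsupport ψ ⊆ V

/-- `H¹(V)` for an open set `V`: square integrable functions whose weak gradient is
square integrable. -/
def H1 (V : Set E3) : Set (E3 → ℝ) :=
  {u | MemLp u 2 (volume.restrict V) ∧
    ∃ g : E3 → E3, MemLp g 2 (volume.restrict V) ∧
      ∀ ψ : E3 → ℝ, IsTestFunction V ψ → ∀ i : Fin 3,
        ∫ x in V, u x * fderiv ℝ ψ x (EuclideanSpace.single i 1) = -∫ x in V, g x i * ψ x}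

/-- `H(div, V)` for an open set `V`: square integrable vector fields whose weak divergence is
square integrable. Here `fderiv ℝ ψ x (u x)` is `⟨∇ψ(x), u(x)⟩`. -/
def Hdiv (V : Set E3) : Set (E3 → E3) :=
  {u | MemLp u 2 (volume.restrict V) ∧
    ∃ g : E3 → ℝ, MemLp g 2 (volume.restrict V) ∧
      ∀ ψ : E3 → ℝ, IsTestFunction V ψ →
        ∫ x in V, fderiv ℝ ψ x (u x) = -∫ x in V, g x * ψ x}

/-! ### The reference tetrahedron

Vertices are numbered `0, 1, 2, 3` (for `v₁, v₂, v₃, v₄`). A polytope (vertex, edge, face or cell)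
is a nonempty set of vertex numbers. A face is named by the vertex opposite to it: the vertices of
the face opposite to `a` are, in ascending order, `a.succAbove 0, a.succAbove 1, a.succAbove 2`. -/

/-- The Cartesian base vectors `e₁, e₂, e₃`. -/
def e1 : E3 := !₂[1, 0, 0]
/-- The second Cartesian base vector. -/
def e2 : E3 := !₂[0, 1, 0]
/-- The third Cartesian base vector. -/
def e3 : E3 := !₂[0, 0, 1]

/-- The vertices `v₁ = 0, v₂ = e₃, v₃ = e₂, v₄ = e₁` of the reference tetrahedron. -/
def refVert : Fin 4 → E3 := ![0, e3, e2, e1]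

/-- The cross product on `E3`. -/
def cross (u v : E3) : E3 := WithLp.toLp 2 (crossProduct u.ofLp v.ofLp)

/-- For a tetrahedron with ordered vertices `P 0, …, P 3`, the normal vector
`(P j - P i) × (P k - P i)` of the face with vertex numbers `i < j < k`, opposite to `a`. Its
length is twice the area of the face. -/
def faceNormal (P : Fin 4 → E3) (a : Fin 4) : E3 :=
  cross (P (a.succAbove 1) - P (a.succAbove 0)) (P (a.succAbove 2) - P (a.succAbove 0))

/-- The closed face opposite to the vertex `a`. -/
def face (P : Fin 4 → E3) (a : Fin 4) : Set E3 := convexHull ℝ (P '' {b | b ≠ a})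

/-- The closed tetrahedron with vertices `P 0, …, P 3`. -/
def tetrahedron (P : Fin 4 → E3) : Set E3 := convexHull ℝ (range P)

/-! ### The underlying scalar basis -/

/-- The number of base functions of each polytope with `k` vertices:
`1` for a vertex, `p - 1` for an edge, `(p - 2)(p - 1)/2` for a face,
`(p - 3)(p - 2)(p - 1)/6` for the cell. -/
def numFun (p k : ℕ) : ℕ := (p - 1).choose (k - 1)

/-- Indices of the base functions of `U^p`: a polytope and a number. -/
abbrev Dof (p : ℕ) : Type :=
  Σ S : {S : Finset (Fin 4) // S.Nonempty}, Fin (numFun p S.1.card)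

/-- The polytope (set of vertex numbers) of an index. -/
def Dof.poly {p : ℕ} (d : Dof p) : Finset (Fin 4) := d.1.1

/-- A polytopal polynomial basis `U^p` on the reference tetrahedron: linearly independent
polynomials associated with the vertices, edges, faces and the cell, in the numbers above
(so `(p+3)(p+2)(p+1)/6` in total), such that a base function associated with a polytope vanishes
on every vertex, edge and face that does not contain that polytope. -/
structure PolytopalBasis (p : ℕ) where
  fn : Dof p → MvPolynomial (Fin 3) ℝ
  linearIndependent : LinearIndependent ℝ fn
  vanish : ∀ (d : Dof p) (Q : Finset (Fin 4)), ¬ d.poly ⊆ Q →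
    ∀ ξ ∈ convexHull ℝ (refVert '' (Q : Set (Fin 4))),
      MvPolynomial.eval (fun i => ξ i) (fn d) = 0

/-- The scalar base function with index `d`, as a function. -/
def PolytopalBasis.shape {p : ℕ} (B : PolytopalBasis p) (d : Dof p) : E3 → ℝ :=
  fun ξ => MvPolynomial.eval (fun i => ξ i) (B.fn d)

/-! ### The polytopal template and the vectorial base functions -/

/-- The template sets `𝒯_S`, three vectors for each polytope `S`. -/
def template (S : Finset (Fin 4)) : Fin 3 → E3 :=
  if S = {0} then ![-e1, e2, -e3]
  else if S = {1} then ![e3 - e1, e2 - e3, -e3]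
  else if S = {2} then ![e2 - e1, e2 - e3, -e2]
  else if S = {3} then ![e2 - e1, e1 - e3, -e1]
  else if S = {0, 1} then ![-e1, e2, e3]
  else if S = {0, 2} then ![-e1, -e3, e2]
  else if S = {0, 3} then ![e2, -e3, e1]
  else if S = {1, 2} then ![e3 - e1, -e3, e2 - e3]
  else if S = {1, 3} then ![e2 - e3, -e3, e1 - e3]
  else if S = {2, 3} then ![e2 - e3, -e2, e1 - e2]
  else if S = {0, 1, 2} then ![-e1, e3, e2]
  else if S = {0, 1, 3} then ![e2, e3, e1]
  else if S = {0, 2, 3} then ![-e3, e2, e1]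
  else if S = {1, 2, 3} then ![-e3, e2 - e3, e1 - e3]
  else ![e3, e2, e1]

/-- The products `n ℓ` of a scalar base function and a template vector of the same polytope. -/
def PolytopalBasis.bdm {p : ℕ} (B : PolytopalBasis p) (d : Dof p) (r : Fin 3) : E3 → E3 :=
  fun ξ => B.shape d ξ • template d.poly r

/-- The `r`-th template vector of the polytope `S` yields base functions of the face opposite to
`a` (vertex-face, edge-face and face functions): `S` is contained in that face, and the normal
trace of the template vector on that face does not vanish. -/
def IsFaceType (a : Fin 4) (S : Finset (Fin 4)) (r : Fin 3) : Prop :=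
  a ∉ S ∧ inner ℝ (faceNormal refVert a) (template S r) ≠ 0

/-- The `r`-th template vector of the polytope `S` yields cell base functions (edge-cell, face-cell
and cell functions): `S` is an edge, a face or the cell, and the normal trace of the template
vector vanishes on every face that contains `S`. -/
def IsCellType (S : Finset (Fin 4)) (r : Fin 3) : Prop :=
  2 ≤ S.card ∧ ∀ a, a ∉ S → inner ℝ (faceNormal refVert a) (template S r) = 0

/-! ### Mapping to the physical element -/

/-- The map from the reference tetrahedron to the tetrahedron with vertices `P 0, …, P 3`, through
barycentric coordinates. -/
def elemMap (P : Fin 4 → E3) (ξ : E3) : E3 :=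
  (1 - ξ 0 - ξ 1 - ξ 2) • P 0 + ξ 2 • P 1 + ξ 1 • P 2 + ξ 0 • P 3

/-- Transformation of scalar functions, `n ∘ x⁻¹`. -/
def push (P : Fin 4 → E3) (n : E3 → ℝ) (x : E3) : ℝ := n (Function.invFun (elemMap P) x)

/-- The contravariant Piola transformation `φ ↦ (det J)⁻¹ J φ`, with `J` the Jacobian of the
element map. -/
def piola (P : Fin 4 → E3) (φ : E3 → E3) (x : E3) : E3 :=
  let ξ := Function.invFun (elemMap P) x
  let J := fderiv ℝ (elemMap P) ξ
  (J.det)⁻¹ • J (φ ξ)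

/-! ### Grids and the global spaces -/

/-- A conforming tetrahedral grid, with the vertices of each element in a fixed order: the
elements are nondegenerate and pairwise distinct, two elements meet exactly in the convex hull of
their common vertices (a common face, edge, vertex, or nothing), and two elements order their common
vertices in the same way. -/
structure TetMesh (κ : Type*) where
  vert : κ → Fin 4 → E3
  indep : ∀ K, AffineIndependent ℝ (vert K)
  distinct : ∀ K K', range (vert K) = range (vert K') → K = K'
  inter : ∀ K K', tetrahedron (vert K) ∩ tetrahedron (vert K') =
    convexHull ℝ (range (vert K) ∩ range (vert K'))
  ordered : ∀ K K' a b a' b', vert K a = vert K' a' → vert K b = vert K' b' → a < b → a' < b'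

namespace TetMesh

variable {κ : Type*} {p : ℕ}

/-- The (open) domain covered by the grid. -/
def domain (M : TetMesh κ) : Set E3 := interior (⋃ K, tetrahedron (M.vert K))

/-- The values of a function on the interior of the element `K`, extended by zero. -/
def onElem {F : Type*} [Zero F] (M : TetMesh κ) (K : κ) (u : E3 → F) : E3 → F :=
  (interior (tetrahedron (M.vert K))).indicator u

open Classical in
/-- The global scalar base function with number `m` of the vertex, edge, face or cell of the grid
with vertex set `s`: on each element of which this is a polytope, the transformed `m`-th base
function of that polytope; zero on the other elements. -/
def globalScalar [Fintype κ] (M : TetMesh κ) (B : PolytopalBasis p) (s : Set E3) (m : ℕ) :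
    E3 → ℝ :=
  ∑ K, ∑ d : Dof p,
    if M.vert K '' (d.poly : Set (Fin 4)) = s ∧ (d.2 : ℕ) = m then
      M.onElem K (push (M.vert K) (B.shape d))
    else 0

/-- The scalar finite element space spanned by `U^p` on the grid. -/
def scalarSpace [Fintype κ] (M : TetMesh κ) (B : PolytopalBasis p) : Submodule ℝ (E3 → ℝ) :=
  Submodule.span ℝ {u | ∃ s m, u = M.globalScalar B s m}

open Classical in
/-- The global non-cell base function of the face of the grid with vertex set `f` that comes
from the `m`-th scalar base function of its polytope with vertex set `s`: on each element of which
`f` is a face, the Piola transform of the corresponding base function `n ℓ` of that face; zero on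
the other elements. (For each polytope of a face there is exactly one template vector of that
polytope whose normal trace on the face does not vanish, so one `r` contributes per element.) -/
def globalFace [Fintype κ] (M : TetMesh κ) (B : PolytopalBasis p) (f s : Set E3) (m : ℕ) :
    E3 → E3 :=
  ∑ K, ∑ a : Fin 4, ∑ d : Dof p, ∑ r : Fin 3,
    if M.vert K '' {b | b ≠ a} = f ∧ M.vert K '' (d.poly : Set (Fin 4)) = s ∧ (d.2 : ℕ) = m ∧
        IsFaceType a d.poly r then
      M.onElem K (piola (M.vert K) (B.bdm d r))
    else 0

/-- The global cell base functions: Piola transforms of cell functions of one element. -/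
def globalCell (M : TetMesh κ) (B : PolytopalBasis p) (K : κ) (d : Dof p) (r : Fin 3) :
    E3 → E3 :=
  M.onElem K (piola (M.vert K) (B.bdm d r))

/-- The finite element space spanned by the Piola transformed `BDM^p` basis on the grid. -/
def bdmSpace [Fintype κ] (M : TetMesh κ) (B : PolytopalBasis p) : Submodule ℝ (E3 → E3) :=
  Submodule.span ℝ
    ({u | ∃ f s m, u = M.globalFace B f s m} ∪
      {u | ∃ K d r, IsCellType d.poly r ∧ u = M.globalCell B K d r})

end TetMesh

end PolytopalBDM

end

/-! Every base function is a scalar polynomial times a constant vector, and the Piola map keeps this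
form (`piola_bdm`). The normal traces then rest on three facts. If `S` lies in a face, exactly one
vector of its template has nonzero trace there; that trace is 1, and the vector is tangential to all
other faces containing `S` (a finite check). On a face not containing `S` the scalar factor
vanishes. Finally `⟨ν_P, J w⟩ = det J ⟨ν_ref, w⟩` (`inner_faceNormal_jac`), so the Piola map
preserves traces against unnormalised normals.

For conformity, apply the divergence theorem on each element to `ψ` times the field
(`setIntegral_fderiv_tetrahedron`). Cell functions leave no boundary term; a function of the face
`f` leaves only the integral over `f` of `ψ` times a signed sum of scalar traces, `traceJump`. The
same sum appears when the scalar function of the same polytope is differentiated weakly. For a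
function in `H¹` the weak gradient is the elementwise gradient almost everywhere, so its boundary
terms cancel; testing with bumps that meet no other face gives `traceJump = 0` on the part of `f`
inside the domain (`traceJump_eq_zero`). Elsewhere on `f` the test function is zero.

One common signed sum serves both fields because the vertex ordering gives all elements at `f` the
same parametrization and normal. Hence it is never necessary to know how many elements meet at `f`,
or on which side they lie. -/

noncomputable section

namespace PolytopalBDM

/-! ### Normal components of the template vectors -/

/-- Integer components of the template vectors. -/
def templateInt (S : Finset (Fin 4)) : Fin 3 → Fin 3 → ℤ :=
  if S = {0} then ![![-1, 0, 0], ![0, 1, 0], ![0, 0, -1]]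
  else if S = {1} then ![![-1, 0, 1], ![0, 1, -1], ![0, 0, -1]]
  else if S = {2} then ![![-1, 1, 0], ![0, 1, -1], ![0, -1, 0]]
  else if S = {3} then ![![-1, 1, 0], ![1, 0, -1], ![-1, 0, 0]]
  else if S = {0, 1} then ![![-1, 0, 0], ![0, 1, 0], ![0, 0, 1]]
  else if S = {0, 2} then ![![-1, 0, 0], ![0, 0, -1], ![0, 1, 0]]
  else if S = {0, 3} then ![![0, 1, 0], ![0, 0, -1], ![1, 0, 0]]
  else if S = {1, 2} then ![![-1, 0, 1], ![0, 0, -1], ![0, 1, -1]]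
  else if S = {1, 3} then ![![0, 1, -1], ![0, 0, -1], ![1, 0, -1]]
  else if S = {2, 3} then ![![0, 1, -1], ![0, -1, 0], ![1, -1, 0]]
  else if S = {0, 1, 2} then ![![-1, 0, 0], ![0, 0, 1], ![0, 1, 0]]
  else if S = {0, 1, 3} then ![![0, 1, 0], ![0, 0, 1], ![1, 0, 0]]
  else if S = {0, 2, 3} then ![![0, 0, -1], ![0, 1, 0], ![1, 0, 0]]
  else if S = {1, 2, 3} then ![![0, 0, -1], ![0, 1, -1], ![1, 0, -1]]
  else ![![0, 0, 1], ![0, 1, 0], ![1, 0, 0]]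

/-- Normal components on the faces of the reference tetrahedron of an integer vector. -/
def normalInt (a : Fin 4) (v : Fin 3 → ℤ) : ℤ :=
  ![-(v 0 + v 1 + v 2), -v 2, v 1, -v 0] a

theorem template_apply (S : Finset (Fin 4)) (r i : Fin 3) :
    template S r i = templateInt S r i := by
  -- Descends one `if` at a time, so that only the matching leaves have to be compared
  -- componentwise.
  have key : ∀ {c : Prop} [Decidable c] {x x' : Fin 3 → E3} {y y' : Fin 3 → Fin 3 → ℤ},
      (∀ r i, x r i = y r i) → (∀ r i, x' r i = y' r i) →
        ∀ r i, (if c then x else x') r i = ((if c then y else y') r i : ℤ) := by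
    intro c _ x x' y y' h h' r i
    split_ifs <;> simp [*]
  revert r i
  unfold template templateInt
  repeat' apply key
  all_goals
    intro r i
    fin_cases r <;> fin_cases i <;> simp [e1, e2, e3]

theorem inner_refNormal (a : Fin 4) (x : E3) :
    inner ℝ (faceNormal refVert a) x = ![-(x 0 + x 1 + x 2), -x 2, x 1, -x 0] a := by
  fin_cases a <;>
    simp [faceNormal, refVert, cross, e1, e2, e3, PiLp.inner_apply, Fin.sum_univ_three,
      crossProduct, Fin.succAbove]
  ring

theorem inner_refNormal_template (a : Fin 4) (S : Finset (Fin 4)) (r : Fin 3) :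
    inner ℝ (faceNormal refVert a) (template S r) = normalInt a (templateInt S r) := by
  rw [inner_refNormal]
  fin_cases a <;> simp [normalInt, template_apply]

-- The template has finitely many vectors with integer components, so the claim is decidable once it
-- is moved from `ℝ` to `ℤ`. The condition `b ∉ S` says that the face opposite to `b` contains `S`.
set_option maxRecDepth 10000 in
theorem normalInt_template : ∀ S : Finset (Fin 4), S.Nonempty → ∀ a : Fin 4, a ∉ S → ∀ r : Fin 3,
    normalInt a (templateInt S r) ≠ 0 →
      normalInt a (templateInt S r) = 1 ∧ (∀ b, b ≠ a → b ∉ S →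
        normalInt b (templateInt S r) = 0) := by
  decide

-- Makes the sum over template vectors in `globalFace` reduce to a single term for each element,
-- face and scalar index.
set_option maxRecDepth 10000 in
theorem existsUnique_normalInt_template : ∀ (S : Finset (Fin 4)), S.Nonempty → ∀ a : Fin 4,
    a ∉ S → ∃ r : Fin 3, normalInt a (templateInt S r) ≠ 0 ∧
      ∀ r', normalInt a (templateInt S r') ≠ 0 → r' = r := by
  decide

theorem IsFaceType.inner_eq_one {a : Fin 4} {S : Finset (Fin 4)} {r : Fin 3}
    (h : IsFaceType a S r) (hS : S.Nonempty) :
    inner ℝ (faceNormal refVert a) (template S r) = 1 := by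
  have h2 := h.2
  rw [inner_refNormal_template] at h2 ⊢
  exact_mod_cast (normalInt_template S hS a h.1 r (by exact_mod_cast h2)).1

theorem IsFaceType.inner_eq_zero {a : Fin 4} {S : Finset (Fin 4)} {r : Fin 3}
    (h : IsFaceType a S r) (hS : S.Nonempty) {b : Fin 4} (hba : b ≠ a) (hb : b ∉ S) :
    inner ℝ (faceNormal refVert b) (template S r) = 0 := by
  have h2 := h.2
  rw [inner_refNormal_template] at h2 ⊢
  exact_mod_cast (normalInt_template S hS a h.1 r (by exact_mod_cast h2)).2 b hba hb

theorem exists_isFaceType_iff {a : Fin 4} {S : Finset (Fin 4)} (hS : S.Nonempty) (ha : a ∉ S) :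
    ∃ r, ∀ r', IsFaceType a S r' ↔ r' = r := by
  obtain ⟨r, hr, h⟩ := existsUnique_normalInt_template S hS a ha
  refine ⟨r, fun r' => ⟨fun h' => h r' ?_, ?_⟩⟩
  · have := h'.2
    rw [inner_refNormal_template] at this
    exact_mod_cast this
  · rintro rfl
    refine ⟨ha, ?_⟩
    rw [inner_refNormal_template]
    exact_mod_cast hr

/-! ### Geometry of a tetrahedron -/

/-- The Jacobian of `elemMap P`. -/
def jac (P : Fin 4 → E3) : E3 →L[ℝ] E3 :=
  (EuclideanSpace.proj (2 : Fin 3) : E3 →L[ℝ] ℝ).smulRight (P 1 - P 0) +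
    (EuclideanSpace.proj (1 : Fin 3) : E3 →L[ℝ] ℝ).smulRight (P 2 - P 0) +
    (EuclideanSpace.proj (0 : Fin 3) : E3 →L[ℝ] ℝ).smulRight (P 3 - P 0)

theorem jac_apply (P : Fin 4 → E3) (ξ : E3) :
    jac P ξ = ξ 2 • (P 1 - P 0) + ξ 1 • (P 2 - P 0) + ξ 0 • (P 3 - P 0) := by
  simp [jac]

theorem elemMap_eq (P : Fin 4 → E3) (ξ : E3) : elemMap P ξ = jac P ξ + P 0 := by
  rw [jac_apply, elemMap]
  module

theorem hasFDerivAt_elemMap (P : Fin 4 → E3) (ξ : E3) :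
    HasFDerivAt (elemMap P) (jac P) ξ := by
  rw [show elemMap P = fun ξ => jac P ξ + P 0 from funext (elemMap_eq P)]
  exact (jac P).hasFDerivAt.add_const _

theorem contDiff_elemMap (P : Fin 4 → E3) : ContDiff ℝ ∞ (elemMap P) := by
  rw [show elemMap P = fun ξ => jac P ξ + P 0 from funext (elemMap_eq P)]
  exact (jac P).contDiff.add contDiff_const

/-- The columns run from `P 3` down to `P 1` because the reference vertices `v₂, v₃, v₄` are `e₃,
e₂, e₁`. -/
theorem det_jac (P : Fin 4 → E3) :
    (jac P).det = (Matrix.of fun i j => (![P 3 - P 0, P 2 - P 0, P 1 - P 0] j) i).det := by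
  rw [ContinuousLinearMap.det, ← LinearMap.det_toMatrix (EuclideanSpace.basisFun (Fin 3) ℝ).toBasis]
  congr 1
  ext i j
  rw [LinearMap.toMatrix_apply]
  fin_cases j <;> simp [jac_apply]

/-- The cofactor identity behind the Piola transformation: a normal paired with `J w` is a triple
product of vectors in the image of `J`, hence scales by `det J`. -/
theorem inner_faceNormal_jac (P : Fin 4 → E3) (a : Fin 4) (w : E3) :
    inner ℝ (faceNormal P a) (jac P w) = (jac P).det * inner ℝ (faceNormal refVert a) w := by
  rw [inner_refNormal, det_jac, Matrix.det_fin_three, jac_apply]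
  fin_cases a <;>
  · simp [faceNormal, cross, PiLp.inner_apply, Fin.sum_univ_three, crossProduct, Fin.succAbove]
    ring

/-- Barycentric coordinates of the reference tetrahedron. -/
def bary (a : Fin 4) (ξ : E3) : ℝ := ![1 - ξ 0 - ξ 1 - ξ 2, ξ 2, ξ 1, ξ 0] a

theorem sum_bary (ξ : E3) : ∑ a, bary a ξ = 1 := by
  simp [bary, Fin.sum_univ_four]

theorem bary_ext {ξ η : E3} (h : ∀ a, bary a ξ = bary a η) : ξ = η := by
  ext i
  fin_cases i
  · exact h 3
  · exact h 2
  · exact h 1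

theorem elemMap_eq_sum (P : Fin 4 → E3) (ξ : E3) : elemMap P ξ = ∑ a, bary a ξ • P a := by
  simp [bary, Fin.sum_univ_four, elemMap]

theorem bary_refVert (a b : Fin 4) : bary a (refVert b) = if a = b then 1 else 0 := by
  fin_cases a <;> fin_cases b <;> simp [bary, refVert, e1, e2, e3]

theorem elemMap_refVert (P : Fin 4 → E3) (a : Fin 4) : elemMap P (refVert a) = P a := by
  simp [elemMap_eq_sum, bary_refVert]

theorem bary_combo (a : Fin 4) (ξ η : E3) {s t : ℝ} (h : s + t = 1) :
    bary a (s • ξ + t • η) = s * bary a ξ + t * bary a η := by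
  obtain rfl : s = 1 - t := by linarith
  fin_cases a <;> simp [bary]
  ring

theorem continuous_bary (a : Fin 4) : Continuous (bary a) := by
  change Continuous fun ξ : E3 => ![1 - ξ 0 - ξ 1 - ξ 2, ξ 2, ξ 1, ξ 0] a
  fin_cases a <;> simp <;> fun_prop

/-- The element map as an affine map. -/
def elemAff (P : Fin 4 → E3) : E3 →ᵃ[ℝ] E3 :=
  (jac P : E3 →ₗ[ℝ] E3).toAffineMap + AffineMap.const ℝ E3 (P 0)

theorem coe_elemAff (P : Fin 4 → E3) : ⇑(elemAff P) = elemMap P := by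
  ext1 ξ
  simp [elemAff, elemMap_eq]

theorem mem_convexHull_refVert (Q : Set (Fin 4)) (ξ : E3) :
    ξ ∈ convexHull ℝ (refVert '' Q) ↔ (∀ a, 0 ≤ bary a ξ) ∧ ∀ a, a ∉ Q → bary a ξ = 0 := by
  constructor
  · revert ξ
    change convexHull ℝ (refVert '' Q) ⊆ {ξ | (∀ a, 0 ≤ bary a ξ) ∧ ∀ a, a ∉ Q → bary a ξ = 0}
    refine convexHull_min ?_ ?_
    · rintro _ ⟨b, hb, rfl⟩
      refine ⟨fun a => ?_, fun a ha => ?_⟩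
      · rw [bary_refVert]; positivity
      · rw [bary_refVert, if_neg]
        rintro rfl
        exact ha hb
    · rintro x ⟨hx, hx'⟩ y ⟨hy, hy'⟩ s t hs ht hst
      refine ⟨fun a => ?_, fun a ha => ?_⟩
      · rw [bary_combo a x y hst]
        have := hx a
        have := hy a
        positivity
      · rw [bary_combo a x y hst, hx' a ha, hy' a ha]
        simp
  · rintro ⟨h0, h1⟩
    classical
    have hid : ξ = ∑ a, bary a ξ • refVert a := by
      rw [← elemMap_eq_sum]
      ext i
      fin_cases i <;> simp [elemMap, refVert, e1, e2, e3]
    rw [hid, ← Finset.sum_filter_of_ne (p := fun a => a ∈ Q)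
      (by intro a _ ha; by_contra hQ; exact ha (by simp [h1 a hQ]))]
    refine (convex_convexHull ℝ _).sum_mem (fun a _ => h0 a) ?_ ?_
    · rw [Finset.sum_filter_of_ne (by intro a _ ha; by_contra hQ; exact ha (h1 a hQ)), sum_bary]
    · intro a ha
      exact subset_convexHull ℝ _ ⟨a, (Finset.mem_filter.1 ha).2, rfl⟩

theorem image_elemMap_convexHull (P : Fin 4 → E3) (Q : Set (Fin 4)) :
    elemMap P '' convexHull ℝ (refVert '' Q) = convexHull ℝ (P '' Q) := by
  rw [← coe_elemAff, AffineMap.image_convexHull, coe_elemAff, image_image]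
  simp only [elemMap_refVert]

section Nondegenerate

variable {P : Fin 4 → E3}

/-- Identifies the explicit reference coordinates with Mathlib's barycentric ones, which supplies
injectivity and the description of the interior. -/
theorem bary_eq_coord (hP : AffineIndependent ℝ P) :
    ∃ b : AffineBasis (Fin 4) ℝ E3, ⇑b = P ∧ ∀ a ξ, b.coord a (elemMap P ξ) = bary a ξ := by
  refine ⟨⟨P, hP, (hP.affineSpan_eq_top_iff_card_eq_finrank_add_one).2 (by simp)⟩, rfl, ?_⟩
  intro a ξ
  set b : AffineBasis (Fin 4) ℝ E3 :=
    ⟨P, hP, (hP.affineSpan_eq_top_iff_card_eq_finrank_add_one).2 (by simp)⟩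
  have := b.coord_apply_combination_of_mem (Finset.mem_univ a) (w := fun a => bary a ξ)
    (sum_bary ξ)
  rw [Finset.univ.affineCombination_eq_linear_combination _ _ (sum_bary ξ)] at this
  rw [elemMap_eq_sum]
  exact this

theorem injective_elemMap (hP : AffineIndependent ℝ P) : Function.Injective (elemMap P) := by
  obtain ⟨b, -, hb⟩ := bary_eq_coord hP
  intro ξ η h
  exact bary_ext fun a => by rw [← hb, ← hb, h]

theorem injective_jac (hP : AffineIndependent ℝ P) : Function.Injective (jac P) := by
  intro ξ η h
  exact injective_elemMap hP (by rw [elemMap_eq, elemMap_eq, h])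

theorem det_jac_ne_zero (hP : AffineIndependent ℝ P) : (jac P).det ≠ 0 := by
  intro h
  have := LinearMap.bot_lt_ker_of_det_eq_zero h
  rw [LinearMap.ker_eq_bot.2 (injective_jac hP)] at this
  exact lt_irrefl _ this

theorem surjective_elemMap (hP : AffineIndependent ℝ P) : Function.Surjective (elemMap P) := by
  intro x
  obtain ⟨ξ, hξ⟩ := (LinearMap.injective_iff_surjective (f := (jac P : E3 →ₗ[ℝ] E3))).1
    (injective_jac hP) (x - P 0)
  exact ⟨ξ, by rw [elemMap_eq]; exact (eq_sub_iff_add_eq.1 hξ)⟩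

theorem push_elemMap (hP : AffineIndependent ℝ P) (n : E3 → ℝ) (ξ : E3) :
    push P n (elemMap P ξ) = n ξ := by
  rw [push, Function.leftInverse_invFun (injective_elemMap hP) ξ]

/-- The Jacobian is constant, so a constant direction stays constant. This is why a divergence
theorem for constant vectors suffices. -/
theorem piola_smul (P : Fin 4 → E3) (n : E3 → ℝ) (l x : E3) :
    piola P (fun ξ => n ξ • l) x = push P n x • ((jac P).det⁻¹ • jac P l) := by
  simp only [piola, push, (hasFDerivAt_elemMap P _).fderiv, map_smul]
  rw [smul_comm]

theorem contDiff_push (hP : AffineIndependent ℝ P) {n : E3 → ℝ} (hn : ContDiff ℝ ∞ n) :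
    ContDiff ℝ ∞ (push P n) := by
  let e := (LinearEquiv.ofInjectiveEndo (jac P : E3 →ₗ[ℝ] E3)
    (injective_jac hP)).toContinuousLinearEquiv
  have he : push P n = fun x => n (e.symm (x - P 0)) := by
    ext x
    obtain ⟨ξ, rfl⟩ := surjective_elemMap hP x
    rw [push_elemMap hP, elemMap_eq, add_sub_cancel_right]
    congr 1
    exact (e.symm_apply_apply ξ).symm
  rw [he]
  exact hn.comp (e.symm.contDiff.comp (contDiff_id.sub contDiff_const))

theorem elemMap_mem_convexHull (hP : AffineIndependent ℝ P) (Q : Set (Fin 4)) (ξ : E3) :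
    elemMap P ξ ∈ convexHull ℝ (P '' Q) ↔
      (∀ a, 0 ≤ bary a ξ) ∧ ∀ a, a ∉ Q → bary a ξ = 0 := by
  rw [← image_elemMap_convexHull, (injective_elemMap hP).mem_set_image, mem_convexHull_refVert]

theorem elemMap_mem_face (hP : AffineIndependent ℝ P) (a : Fin 4) (ξ : E3) :
    elemMap P ξ ∈ face P a ↔ (∀ b, 0 ≤ bary b ξ) ∧ bary a ξ = 0 := by
  rw [face, elemMap_mem_convexHull hP]
  simp

/-- The open reference tetrahedron. -/
def refOpen : Set E3 := {ξ | ∀ a, 0 < bary a ξ}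

theorem interior_tetrahedron (hP : AffineIndependent ℝ P) :
    interior (tetrahedron P) = elemMap P '' refOpen := by
  obtain ⟨b, hbP, hb⟩ := bary_eq_coord hP
  have := b.interior_convexHull
  rw [hbP] at this
  rw [tetrahedron, this]
  ext x
  obtain ⟨ξ, rfl⟩ := surjective_elemMap hP x
  rw [(injective_elemMap hP).mem_set_image]
  simp [hb, refOpen]

theorem isOpen_refOpen : IsOpen refOpen := by
  simp only [refOpen, ofPred_forall]
  exact isOpen_iInter_of_finite fun a => isOpen_lt continuous_const (continuous_bary a)

theorem setIntegral_interior_tetrahedron (hP : AffineIndependent ℝ P) (g : E3 → ℝ) :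
    ∫ x in interior (tetrahedron P), g x = |(jac P).det| * ∫ ξ in refOpen, g (elemMap P ξ) := by
  rw [interior_tetrahedron hP, integral_image_eq_integral_abs_det_fderiv_smul volume
    isOpen_refOpen.measurableSet (fun ξ _ => (hasFDerivAt_elemMap P ξ).hasFDerivWithinAt)
    (injective_elemMap hP).injOn]
  simp only [smul_eq_mul]
  rw [integral_const_mul]

theorem isCompact_tetrahedron (P : Fin 4 → E3) : IsCompact (tetrahedron P) :=
  (finite_range P).isCompact_convexHull ℝ

theorem isCompact_face (P : Fin 4 → E3) (a : Fin 4) : IsCompact (face P a) :=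
  ((toFinite _).image P).isCompact_convexHull ℝ

theorem volume_face (hP : AffineIndependent ℝ P) (a : Fin 4) : volume (face P a) = 0 := by
  refine measure_mono_null (convexHull_subset_affineSpan _)
    (Measure.addHaar_affineSubspace volume _ fun h => ?_)
  have := hP.notMem_affineSpan_sdiff a univ
  rw [show (univ \ {a} : Set (Fin 4)) = {b | b ≠ a} by ext; simp, h] at this
  exact this (AffineSubspace.mem_top ℝ E3 _)

end Nondegenerate

/-! ### The divergence theorem on a tetrahedron -/

/-- The open standard triangle. -/
def tri : Set (ℝ × ℝ) := {y | 0 < y.1 ∧ 0 < y.2 ∧ y.1 + y.2 < 1}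

/-- The affine parametrization of the triangle with vertices `Q` by the standard triangle. -/
def faceParam (Q : Fin 3 → E3) (y : ℝ × ℝ) : E3 :=
  Q 0 + y.1 • (Q 1 - Q 0) + y.2 • (Q 2 - Q 0)

/-- The integral over the triangle with vertices `Q`, in the affine parametrization. -/
def faceInt (Q : Fin 3 → E3) (h : E3 → ℝ) : ℝ := ∫ y in tri, h (faceParam Q y)

/-- The sign that turns the normal vector of a face of the reference tetrahedron outward. -/
def faceSign (a : Fin 4) : ℝ := ![-1, 1, -1, 1] a

theorem isOpen_tri : IsOpen tri :=
  (isOpen_lt continuous_const continuous_fst).inter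
    ((isOpen_lt continuous_const continuous_snd).inter
      (isOpen_lt (continuous_fst.add continuous_snd) continuous_const))

theorem tri_subset_Icc : tri ⊆ Icc 0 1 := by
  rintro ⟨s, t⟩ ⟨hs, ht, hst⟩
  simp only at hs ht hst
  refine ⟨⟨?_, ?_⟩, ⟨?_, ?_⟩⟩ <;> simp <;> linarith

theorem continuous_faceParam (Q : Fin 3 → E3) : Continuous (faceParam Q) := by
  unfold faceParam
  fun_prop

theorem integrableOn_tri {h : ℝ × ℝ → ℝ} (hh : Continuous h) : IntegrableOn h tri :=
  (hh.continuousOn.integrableOn_compact isCompact_Icc).mono_set tri_subset_Icc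

theorem setIntegral_tri_swap (h : ℝ × ℝ → ℝ) :
    ∫ y in tri, h (y.2, y.1) = ∫ y in tri, h y := by
  have := (Measure.measurePreserving_swap (μ := (volume : Measure ℝ))
    (ν := (volume : Measure ℝ))).setIntegral_preimage_emb
    MeasurableEquiv.prodComm.measurableEmbedding h tri
  rw [Measure.volume_eq_prod, ← this]
  congr 2
  ext ⟨s, t⟩
  simp only [tri, mem_ofPred_eq, mem_preimage, Prod.swap]
  constructor <;> rintro ⟨h1, h2, h3⟩ <;> exact ⟨h2, h1, by linarith⟩

/-- The map is a shear over the first coordinate whose fibre maps `t ↦ 1 - s - t` preserve Lebesgue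
measure. Together with the swap it accounts for the different coordinate parametrizations of the
slanted face. -/
theorem setIntegral_tri_reflect (h : ℝ × ℝ → ℝ) :
    ∫ y in tri, h (y.1, 1 - y.1 - y.2) = ∫ y in tri, h y := by
  have hmp : MeasurePreserving (fun y : ℝ × ℝ => (y.1, 1 - y.1 - y.2))
      ((volume : Measure ℝ).prod volume) ((volume : Measure ℝ).prod volume) :=
    (MeasurePreserving.id volume).skew_product (g := fun s t => 1 - s - t) (by fun_prop)
      (Filter.Eventually.of_forall fun s => (Measure.measurePreserving_sub_left volume _).map_eq)
  have hemb : MeasurableEmbedding (fun y : ℝ × ℝ => (y.1, 1 - y.1 - y.2)) :=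
    (MeasurableEquiv.ofInvolutive _ (fun y => by ext <;> simp) (by fun_prop)).measurableEmbedding
  rw [Measure.volume_eq_prod, ← hmp.setIntegral_preimage_emb hemb h tri]
  congr 2
  ext ⟨s, t⟩
  simp only [tri, mem_ofPred_eq, mem_preimage]
  constructor <;> rintro ⟨h1, h2, h3⟩ <;> refine ⟨h1, ?_, ?_⟩ <;> linarith

/-- Splitting off the `i`-th coordinate. -/
def splitCoord (i : Fin 3) : ℝ × ℝ × ℝ ≃ᵐ E3 :=
  ((MeasurableEquiv.refl ℝ).prodCongr MeasurableEquiv.finTwoArrow.symm).trans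
    ((MeasurableEquiv.piFinSuccAbove (fun _ => ℝ) i).symm.trans (MeasurableEquiv.toLp 2 _))

theorem splitCoord_apply (i : Fin 3) (x : ℝ × ℝ × ℝ) :
    splitCoord i x = WithLp.toLp 2 (i.insertNth x.1 ![x.2.1, x.2.2]) := rfl

theorem measurePreserving_splitCoord (i : Fin 3) :
    MeasurePreserving (splitCoord i) volume volume := by
  have h1 : MeasurePreserving ((MeasurableEquiv.refl ℝ).prodCongr
      (MeasurableEquiv.finTwoArrow (α := ℝ)).symm) volume volume :=
    (MeasurePreserving.id volume).prod (volume_preserving_finTwoArrow ℝ).symm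
  exact (PiLp.volume_preserving_toLp (Fin 3)).comp
    ((volume_preserving_piFinSuccAbove (fun _ => ℝ) i).symm.comp h1)

theorem splitCoord_mem_refOpen (i : Fin 3) (x : ℝ × ℝ × ℝ) :
    splitCoord i x ∈ refOpen ↔ x.2 ∈ tri ∧ x.1 ∈ Ioo 0 (1 - x.2.1 - x.2.2) := by
  rw [splitCoord_apply]
  simp only [refOpen, mem_ofPred_eq, bary, tri, mem_Ioo, Fin.forall_fin_succ]
  fin_cases i <;> simp [Fin.insertNth, Fin.succAboveCases] <;> grind

theorem integrableOn_refOpen {g : E3 → ℝ} (hg : Continuous g) : IntegrableOn g refOpen := by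
  refine (hg.continuousOn.integrableOn_compact (isCompact_tetrahedron refVert)).mono_set ?_
  intro ξ hξ
  rw [tetrahedron, ← image_univ, mem_convexHull_refVert]
  exact ⟨fun a => (hξ a).le, fun a ha => absurd (mem_univ a) ha⟩

theorem setIntegral_refOpen (i : Fin 3) {g : E3 → ℝ} (hg : Continuous g) :
    ∫ ξ in refOpen, g ξ =
      ∫ y in tri, ∫ t in (0)..(1 - y.1 - y.2), g (splitCoord i (t, y)) := by
  rw [← (measurePreserving_splitCoord i).setIntegral_preimage_emb
    (splitCoord i).measurableEmbedding]
  have hint' := ((measurePreserving_splitCoord i).integrableOn_comp_preimage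
    (splitCoord i).measurableEmbedding).2 (integrableOn_refOpen hg)
  have hmeas : MeasurableSet (splitCoord i ⁻¹' refOpen) :=
    (splitCoord i).measurable isOpen_refOpen.measurableSet
  rw [← integral_indicator hmeas, Measure.volume_eq_prod, integral_prod_symm]
  · rw [← integral_indicator isOpen_tri.measurableSet]
    congr 1
    ext y
    by_cases hy : y ∈ tri
    · rw [indicator_of_mem hy, intervalIntegral.integral_of_le (by linarith [hy.2.2]),
        integral_Ioc_eq_integral_Ioo, ← integral_indicator measurableSet_Ioo]
      congr 1
      ext t
      simp only [indicator, mem_preimage, splitCoord_mem_refOpen, hy, true_and]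
    · rw [indicator_of_notMem hy]
      refine integral_eq_zero_of_ae (Filter.Eventually.of_forall fun t => ?_)
      simp [indicator, splitCoord_mem_refOpen, hy]
  · rw [← Measure.volume_eq_prod]
    exact (integrable_indicator_iff hmeas).2 hint'

/-- The fundamental theorem of calculus on lines in direction `i`, which enter through the face `ξ i
= 0` and leave through the slanted one. -/
theorem setIntegral_fderiv_single (i : Fin 3) {h : E3 → ℝ} (hh : ContDiff ℝ ∞ h) :
    ∫ ξ in refOpen, fderiv ℝ h ξ (EuclideanSpace.single i 1) =
      (∫ y in tri, h (splitCoord i (1 - y.1 - y.2, y))) -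
        ∫ y in tri, h (splitCoord i (0, y)) := by
  have hc : Continuous fun ξ => fderiv ℝ h ξ (EuclideanSpace.single i 1) :=
    (hh.continuous_fderiv (by simp)).clm_apply continuous_const
  -- `base y` is the foot of the line on the coordinate plane.
  obtain ⟨base, hbase, hsc⟩ : ∃ base : ℝ × ℝ → E3, Continuous base ∧ ∀ y t, splitCoord i (t, y) =
      base y + t • EuclideanSpace.single i 1 := by
    refine ⟨fun y => splitCoord i (0, y), ?_, fun y t => ?_⟩
    · simp only [splitCoord_apply]
      refine (PiLp.continuous_toLp 2 _).comp (continuous_pi fun j => ?_)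
      fin_cases i <;> fin_cases j <;> simp [Fin.insertNth, Fin.succAboveCases] <;> fun_prop
    · simp only [splitCoord_apply]
      ext j
      fin_cases i <;> fin_cases j <;> simp [Fin.insertNth, Fin.succAboveCases]
  have hh' := hh.continuous
  simp only [setIntegral_refOpen i hc, hsc]
  rw [← integral_sub (integrableOn_tri (by fun_prop)) (integrableOn_tri (by fun_prop))]
  congr 1
  ext y
  rw [intervalIntegral.integral_eq_sub_of_hasDerivAt
    (f := fun t => h (base y + t • EuclideanSpace.single i 1))]
  · intro t _
    have h1 : HasDerivAt (fun t : ℝ => base y + t • EuclideanSpace.single i (1 : ℝ))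
        (EuclideanSpace.single i 1) t := by
      simpa using ((hasDerivAt_id t).smul_const (EuclideanSpace.single i (1 : ℝ))).const_add
        (base y)
    exact ((hh.differentiable (by simp)).differentiableAt.hasFDerivAt).comp_hasDerivAt t h1
  · exact (hc.comp (by fun_prop : Continuous fun t : ℝ =>
      base y + t • EuclideanSpace.single i (1 : ℝ))).intervalIntegrable _ _

theorem faceInt_eq_integral_swap (Q : Fin 3 → E3) (h : E3 → ℝ) :
    faceInt Q h = ∫ y in tri, h (faceParam Q (y.2, y.1)) :=
  (setIntegral_tri_swap fun y => h (faceParam Q y)).symm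

/-- The face `ξ i = 0` is opposite to the vertex at the `i`-th unit vector, whose number is `![3, 2,
1] i`. -/
theorem setIntegral_coordinate_face (i : Fin 3) (h : E3 → ℝ) :
    ∫ y in tri, h (splitCoord i (0, y)) =
      faceInt (fun j => refVert ((![3, 2, 1] i : Fin 4).succAbove j)) h := by
  rw [faceInt_eq_integral_swap]
  congr 1
  ext y
  congr 1
  ext j
  fin_cases i <;> fin_cases j <;>
    simp [splitCoord_apply, Fin.insertNth, Fin.succAboveCases, faceParam, refVert, e1, e2, e3,
      Fin.succAbove]

theorem setIntegral_slanted_face (i : Fin 3) (h : E3 → ℝ) :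
    ∫ y in tri, h (splitCoord i (1 - y.1 - y.2, y)) =
      faceInt (fun j => refVert ((0 : Fin 4).succAbove j)) h := by
  have key : ∀ y : ℝ × ℝ, faceParam (fun j => refVert ((0 : Fin 4).succAbove j)) y =
      !₂[y.2, y.1, 1 - y.1 - y.2] := by
    intro y
    ext j
    fin_cases j <;> simp [faceParam, refVert, e1, e2, e3, Fin.succAbove]
    ring
  simp only [faceInt, key, splitCoord_apply]
  fin_cases i
  · refine Eq.trans ?_ (setIntegral_tri_reflect _)
    congr 1
    ext y
    congr 1
    ext j
    fin_cases j <;> simp [Fin.insertNth, Fin.succAboveCases]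
  · refine Eq.trans ?_ (setIntegral_tri_swap _)
    refine Eq.trans ?_ (setIntegral_tri_reflect _)
    congr 1
    ext y
    congr 1
    ext j
    fin_cases j <;> simp [Fin.insertNth, Fin.succAboveCases]
    ring
  · refine Eq.trans ?_ (setIntegral_tri_swap _)
    congr 1
    ext y
    congr 1
    ext j
    fin_cases j <;> simp [Fin.insertNth, Fin.succAboveCases]
    ring

/-- No area factor appears: the length of the unnormalised normal is exactly the surface Jacobian of
the face parametrization. -/
theorem setIntegral_fderiv_refOpen {h : E3 → ℝ} (hh : ContDiff ℝ ∞ h) (l : E3) :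
    ∫ ξ in refOpen, fderiv ℝ h ξ l =
      ∑ a, faceSign a * inner ℝ (faceNormal refVert a) l *
        faceInt (fun j => refVert (a.succAbove j)) h := by
  have hl : l = ∑ i, l i • EuclideanSpace.single i (1 : ℝ) := by
    ext j
    simp [Fin.sum_univ_three]
    fin_cases j <;> simp
  have h1 : ∀ ξ, fderiv ℝ h ξ l = ∑ i, l i * fderiv ℝ h ξ (EuclideanSpace.single i 1) := by
    intro ξ
    conv_lhs => rw [hl]
    simp only [map_sum, map_smul, smul_eq_mul]
  have hc : ∀ i, Continuous fun ξ => fderiv ℝ h ξ (EuclideanSpace.single i 1) := fun i =>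
    (hh.continuous_fderiv (by simp)).clm_apply continuous_const
  simp only [h1]
  rw [integral_finsetSum _ fun i _ => (integrableOn_refOpen (hc i)).const_mul (l i)]
  simp only [integral_const_mul, setIntegral_fderiv_single _ hh, setIntegral_coordinate_face,
    setIntegral_slanted_face, inner_refNormal]
  simp [Fin.sum_univ_three, Fin.sum_univ_four, faceSign]
  ring

theorem elemMap_faceParam (P : Fin 4 → E3) (Q : Fin 3 → E3) (y : ℝ × ℝ) :
    elemMap P (faceParam Q y) = faceParam (fun j => elemMap P (Q j)) y := by
  simp only [faceParam, elemMap_eq, map_add, map_smul, map_sub, add_sub_add_right_eq_sub]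
  abel

/-- The divergence theorem on a tetrahedron, for the product of a scalar function and a constant
vector. -/
theorem setIntegral_fderiv_tetrahedron {P : Fin 4 → E3} (hP : AffineIndependent ℝ P) {h : E3 → ℝ}
    (hh : ContDiff ℝ ∞ h) (c : E3) :
    ∫ x in interior (tetrahedron P), fderiv ℝ h x c =
      ∑ a, (SignType.sign (jac P).det : ℝ) * faceSign a * inner ℝ (faceNormal P a) c *
        faceInt (fun j => P (a.succAbove j)) h := by
  obtain ⟨l, rfl⟩ := (LinearMap.injective_iff_surjective (f := (jac P : E3 →ₗ[ℝ] E3))).1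
    (injective_jac hP) c
  change ∫ x in interior (tetrahedron P), fderiv ℝ h x (jac P l) =
    ∑ a, (SignType.sign (jac P).det : ℝ) * faceSign a * inner ℝ (faceNormal P a) (jac P l) * _
  have h1 : ∀ ξ, fderiv ℝ h (elemMap P ξ) (jac P l) = fderiv ℝ (fun η => h (elemMap P η)) ξ l := by
    intro ξ
    have := ((hh.differentiable (by simp)).differentiableAt.hasFDerivAt (x := elemMap P ξ)).comp ξ
      (hasFDerivAt_elemMap P ξ)
    rw [show (fun η => h (elemMap P η)) = h ∘ elemMap P from rfl, this.fderiv]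
    rfl
  rw [setIntegral_interior_tetrahedron hP]
  simp only [h1]
  rw [setIntegral_fderiv_refOpen (h := fun η => h (elemMap P η)) (hh.comp (contDiff_elemMap P)),
    Finset.mul_sum]
  refine Finset.sum_congr rfl fun a _ => ?_
  have h2 : faceInt (fun j => refVert (a.succAbove j)) (fun η => h (elemMap P η)) =
      faceInt (fun j => P (a.succAbove j)) h := by
    simp only [faceInt, elemMap_faceParam, elemMap_refVert]
  -- The change of variables yields `|det J|` but the normals scale by `det J`; the quotient is the
  -- sign that corrects for orientation-reversing vertex orders.
  rw [h2, inner_faceNormal_jac, ← sign_mul_self (jac P).det]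
  ring

theorem bary_faceParam (b : Fin 4) (Q : Fin 3 → E3) (y : ℝ × ℝ) :
    bary b (faceParam Q y) = ∑ j, ![1 - y.1 - y.2, y.1, y.2] j * bary b (Q j) := by
  fin_cases b <;> simp [bary, faceParam, Fin.sum_univ_three] <;> ring

theorem weight_pos {y : ℝ × ℝ} (hy : y ∈ tri) (j : Fin 3) :
    0 < (![1 - y.1 - y.2, y.1, y.2] : Fin 3 → ℝ) j := by
  obtain ⟨h1, h2, h3⟩ := hy
  fin_cases j
  · simpa using by linarith
  · exact h1
  · exact h2

theorem bary_faceParam_refVert (b : Fin 4) (e : Fin 3 → Fin 4) (y : ℝ × ℝ) :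
    bary b (faceParam (fun j => refVert (e j)) y) =
      ∑ j, if b = e j then (![1 - y.1 - y.2, y.1, y.2] : Fin 3 → ℝ) j else 0 := by
  simp only [bary_faceParam, bary_refVert, mul_ite, mul_one, mul_zero]

/-- The numbering `e` is arbitrary because the vertices of a face will also be numbered by those of
a neighbouring element. -/
theorem bary_faceParam_refVert_pos (e : Fin 3 → Fin 4) {y : ℝ × ℝ} (hy : y ∈ tri) (j : Fin 3) :
    0 < bary (e j) (faceParam (fun j => refVert (e j)) y) := by
  rw [bary_faceParam_refVert]
  refine Finset.sum_pos' (fun i _ => ?_) ⟨j, Finset.mem_univ j, ?_⟩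
  · split_ifs
    exacts [(weight_pos hy i).le, le_rfl]
  · rw [if_pos rfl]
    exact weight_pos hy j

theorem faceParam_eq_elemMap (P : Fin 4 → E3) (a : Fin 4) (y : ℝ × ℝ) :
    faceParam (fun j => P (a.succAbove j)) y =
      elemMap P (faceParam (fun j => refVert (a.succAbove j)) y) := by
  simp only [elemMap_faceParam, elemMap_refVert]

theorem faceParam_mem_face {P : Fin 4 → E3} (hP : AffineIndependent ℝ P) (a : Fin 4) {y : ℝ × ℝ}
    (hy : y ∈ tri) : faceParam (fun j => P (a.succAbove j)) y ∈ face P a := by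
  rw [faceParam_eq_elemMap, elemMap_mem_face hP]
  refine ⟨fun b => ?_, ?_⟩ <;> rw [bary_faceParam_refVert]
  · refine Finset.sum_nonneg fun j _ => ?_
    split_ifs
    exacts [(weight_pos hy j).le, le_rfl]
  · exact Finset.sum_eq_zero fun j _ => if_neg (Fin.succAbove_ne a j).symm

theorem faceInt_eq_zero {P : Fin 4 → E3} (hP : AffineIndependent ℝ P) (a : Fin 4) {h : E3 → ℝ}
    (hh : ∀ x ∈ face P a, h x = 0) : faceInt (fun j => P (a.succAbove j)) h = 0 :=
  setIntegral_eq_zero_of_forall_eq_zero fun _ hy => hh _ (faceParam_mem_face hP a hy)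

/-! ### Piecewise smooth functions on a grid -/

namespace TetMesh

variable {κ : Type*} (M : TetMesh κ)

theorem interior_subset_domain (K : κ) : interior (tetrahedron (M.vert K)) ⊆ M.domain :=
  interior_mono (subset_iUnion (fun K => tetrahedron (M.vert K)) K)

theorem isOpen_domain : IsOpen M.domain := isOpen_interior

theorem isFiniteMeasure_domain [Finite κ] : IsFiniteMeasure (volume.restrict M.domain) := by
  refine ⟨?_⟩
  rw [Measure.restrict_apply_univ]
  exact (measure_mono interior_subset).trans_lt
    (isCompact_iUnion fun K => isCompact_tetrahedron (M.vert K)).measure_lt_top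

theorem memLp_onElem {F : Type*} [NormedAddCommGroup F] [MeasurableSpace F] [BorelSpace F]
    [SecondCountableTopology F] (K : κ) {w : E3 → F} (hw : Continuous w)
    (q : ENNReal) (μ : Measure E3) [IsFiniteMeasureOnCompacts μ] : MemLp (M.onElem K w) q μ := by
  rw [onElem, memLp_indicator_iff_restrict isOpen_interior.measurableSet]
  have hc := isCompact_tetrahedron (M.vert K)
  obtain ⟨C, hC⟩ := hc.exists_bound_of_continuousOn hw.continuousOn
  have : IsFiniteMeasure (μ.restrict (interior (tetrahedron (M.vert K)))) :=
    ⟨by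
      rw [Measure.restrict_apply_univ]
      exact (measure_mono interior_subset).trans_lt hc.measure_lt_top⟩
  refine MemLp.of_bound hw.aestronglyMeasurable C ?_
  refine (ae_restrict_iff' isOpen_interior.measurableSet).2 (Filter.Eventually.of_forall ?_)
  exact fun x hx => hC x (interior_subset hx)

theorem integrable_onElem (K : κ) {w : E3 → ℝ} (hw : Continuous w)
    (μ : Measure E3) [IsFiniteMeasureOnCompacts μ] : Integrable (M.onElem K w) μ :=
  memLp_one_iff_integrable.1 (M.memLp_onElem K hw 1 μ)

theorem setIntegral_onElem (K : κ) (w : E3 → ℝ) :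
    ∫ x in M.domain, M.onElem K w x = ∫ x in interior (tetrahedron (M.vert K)), w x := by
  rw [onElem, setIntegral_indicator isOpen_interior.measurableSet,
    inter_eq_self_of_subset_right (M.interior_subset_domain K)]

theorem setIntegral_sum_onElem {ι : Type*} (T : Finset ι) (K : ι → κ) {w : ι → E3 → ℝ}
    (hw : ∀ t ∈ T, Continuous (w t)) :
    ∫ x in M.domain, ∑ t ∈ T, M.onElem (K t) (w t) x =
      ∑ t ∈ T, ∫ x in interior (tetrahedron (M.vert (K t))), w t x := by
  rw [integral_finsetSum _ fun t ht => M.integrable_onElem (K t) (hw t ht) _]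
  simp only [setIntegral_onElem]

theorem map_onElem {F : Type*} [Zero F] (K : κ) (w : E3 → F) (φ : E3 → F → ℝ)
    (hφ : ∀ x, φ x 0 = 0) (x : E3) :
    φ x (M.onElem K w x) = M.onElem K (fun x => φ x (w x)) x := by
  by_cases hx : x ∈ interior (tetrahedron (M.vert K)) <;> simp [onElem, hx, hφ]

theorem fderiv_mul_apply_of_contDiff {ψ v : E3 → ℝ} (hψ : ContDiff ℝ ∞ ψ) (hv : ContDiff ℝ ∞ v)
    (x c : E3) : fderiv ℝ (fun x => ψ x * v x) x c = v x * fderiv ℝ ψ x c + fderiv ℝ v x c * ψ x := by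
  rw [fderiv_fun_mul (hψ.differentiable (by simp)).differentiableAt
    (hv.differentiable (by simp)).differentiableAt]
  simp
  ring

theorem continuous_fderiv_apply {v : E3 → ℝ} (hv : ContDiff ℝ ∞ v) (c : E3) :
    Continuous fun x => fderiv ℝ v x c :=
  (hv.continuous_fderiv (by simp)).clm_apply continuous_const

/-- Integration by parts, element by element, for piecewise smooth fields. -/
theorem sum_setIntegral_fderiv_mul {ι : Type*} (T : Finset ι) (K : ι → κ) {v : ι → E3 → ℝ}
    (c : ι → E3) (hv : ∀ t ∈ T, ContDiff ℝ ∞ (v t)) {ψ : E3 → ℝ} (hψ : ContDiff ℝ ∞ ψ) :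
    ∑ t ∈ T, ∫ x in interior (tetrahedron (M.vert (K t))), fderiv ℝ (fun x => ψ x * v t x) x (c t) =
      (∫ x in M.domain, ∑ t ∈ T, M.onElem (K t) (fun x => v t x * fderiv ℝ ψ x (c t)) x) +
        ∫ x in M.domain, (∑ t ∈ T, M.onElem (K t) (fun x => fderiv ℝ (v t) x (c t)) x) * ψ x := by
  have h1 : ∀ x, (∑ t ∈ T, M.onElem (K t) (fun x => fderiv ℝ (v t) x (c t)) x) * ψ x =
      ∑ t ∈ T, M.onElem (K t) (fun x => fderiv ℝ (v t) x (c t) * ψ x) x := by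
    intro x
    rw [Finset.sum_mul]
    exact Finset.sum_congr rfl fun t _ =>
      M.map_onElem (K t) _ (fun x z => z * ψ x) (fun x => zero_mul _) x
  have hc1 : ∀ t ∈ T, Continuous fun x => v t x * fderiv ℝ ψ x (c t) := fun t ht =>
    (hv t ht).continuous.mul (continuous_fderiv_apply hψ _)
  have hc2 : ∀ t ∈ T, Continuous fun x => fderiv ℝ (v t) x (c t) * ψ x := fun t ht =>
    (continuous_fderiv_apply (hv t ht) _).mul hψ.continuous
  simp only [h1]
  rw [M.setIntegral_sum_onElem T K hc1, M.setIntegral_sum_onElem T K hc2,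
    ← Finset.sum_add_distrib]
  refine Finset.sum_congr rfl fun t ht => ?_
  have hi : ∀ {w : E3 → ℝ}, Continuous w →
      IntegrableOn w (interior (tetrahedron (M.vert (K t)))) := fun hw =>
    (hw.continuousOn.integrableOn_compact (isCompact_tetrahedron _)).mono_set interior_subset
  rw [← integral_add (hi (hc1 t ht)) (hi (hc2 t ht))]
  congr 1
  ext x
  exact fderiv_mul_apply_of_contDiff hψ (hv t ht) x (c t)

/-- A piecewise smooth field lies in `H(div)` if its elementwise normal traces cancel in the
weak sense. -/
theorem sum_onElem_mem_Hdiv {ι : Type*} (T : Finset ι) (K : ι → κ) {v : ι → E3 → ℝ}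
    (c : ι → E3) (hv : ∀ t ∈ T, ContDiff ℝ ∞ (v t))
    (h : ∀ ψ, IsTestFunction M.domain ψ → ∑ t ∈ T,
      ∫ x in interior (tetrahedron (M.vert (K t))), fderiv ℝ (fun x => ψ x * v t x) x (c t) = 0) :
    (∑ t ∈ T, M.onElem (K t) (fun x => v t x • c t)) ∈ Hdiv M.domain := by
  refine ⟨?_, fun x => ∑ t ∈ T, M.onElem (K t) (fun x => fderiv ℝ (v t) x (c t)) x, ?_, ?_⟩
  · simp only [Finset.sum_fn]
    exact memLp_finsetSum T fun t ht =>
      M.memLp_onElem (K t) ((hv t ht).continuous.smul continuous_const) 2 _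
  · exact memLp_finsetSum T fun t ht =>
      M.memLp_onElem (K t) (continuous_fderiv_apply (hv t ht) _) 2 _
  · intro ψ hψ
    have h1 := h ψ hψ
    rw [M.sum_setIntegral_fderiv_mul T K c hv hψ.1] at h1
    rw [← eq_neg_iff_add_eq_zero.2 h1]
    congr 1
    ext x
    rw [Finset.sum_apply, map_sum]
    refine Finset.sum_congr rfl fun t _ => ?_
    rw [M.map_onElem (K t) _ (fun x z => fderiv ℝ ψ x z) (fun x => map_zero _) x]
    simp only [map_smul, smul_eq_mul]

/-- For a piecewise smooth function in `H¹` the elementwise traces cancel in the weak sense. -/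
theorem sum_setIntegral_fderiv_eq_zero [Finite κ] {ι : Type*} (T : Finset ι) (K : ι → κ)
    {v : ι → E3 → ℝ} (hv : ∀ t ∈ T, ContDiff ℝ ∞ (v t))
    (h : (∑ t ∈ T, M.onElem (K t) (v t)) ∈ H1 M.domain) {ψ : E3 → ℝ}
    (hψ : IsTestFunction M.domain ψ) (i : Fin 3) :
    ∑ t ∈ T, ∫ x in interior (tetrahedron (M.vert (K t))),
      fderiv ℝ (fun x => ψ x * v t x) x (EuclideanSpace.single i 1) = 0 := by
  have := M.isFiniteMeasure_domain
  obtain ⟨-, g, hg, hweak⟩ := h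
  set G : E3 → ℝ := fun x =>
    ∑ t ∈ T, M.onElem (K t) (fun x => fderiv ℝ (v t) x (EuclideanSpace.single i 1)) x
  have hparts : ∀ ψ, IsTestFunction M.domain ψ →
      ∑ t ∈ T, ∫ x in interior (tetrahedron (M.vert (K t))),
        fderiv ℝ (fun x => ψ x * v t x) x (EuclideanSpace.single i 1) =
      -(∫ x in M.domain, g x i * ψ x) + ∫ x in M.domain, G x * ψ x := by
    intro ψ hψ
    rw [M.sum_setIntegral_fderiv_mul T K _ hv hψ.1, ← hweak ψ hψ i]
    congr 2
    ext x
    rw [Finset.sum_apply, Finset.sum_mul]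
    exact Finset.sum_congr rfl fun t _ => (M.map_onElem (K t) _
      (fun x z => z * fderiv ℝ ψ x (EuclideanSpace.single i 1)) (fun x => zero_mul _) x).symm
  have hgi : Integrable (fun x => g x i) (volume.restrict M.domain) := by
    have h1 : Integrable g (volume.restrict M.domain) := hg.integrable (by norm_num)
    exact (EuclideanSpace.proj i : E3 →L[ℝ] ℝ).integrable_comp h1
  have hGi : Integrable G (volume.restrict M.domain) :=
    integrable_finsetSum T fun t ht =>
      M.integrable_onElem (K t) (continuous_fderiv_apply (hv t ht) _) _
  -- A test function supported off the faces produces no boundary terms, so on `W` the weak gradient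
  -- must agree with the elementwise gradient `G`.
  set W : Set E3 := M.domain \ ⋃ K, ⋃ a, face (M.vert K) a
  have hWo : IsOpen W := M.isOpen_domain.sdiff
    (isClosed_iUnion_of_finite fun K => isClosed_iUnion_of_finite fun a =>
      (isCompact_face _ a).isClosed)
  have hWV : W ⊆ M.domain := sdiff_subset
  have hae : ∀ᵐ x, x ∈ W → g x i - G x = 0 := by
    refine hWo.ae_eq_zero_of_integral_contDiff_smul_eq_zero ?_ fun ψ hψ1 hψ2 hψ3 => ?_
    · exact IntegrableOn.locallyIntegrableOn ((hgi.sub hGi).mono_measure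
        (Measure.restrict_mono hWV le_rfl))
    · have hψ : IsTestFunction M.domain ψ := ⟨hψ1, hψ2, hψ3.trans hWV⟩
      have h1 := hparts ψ hψ
      rw [Finset.sum_eq_zero] at h1
      · obtain ⟨C, hC⟩ := hψ1.continuous.bounded_above_of_compact_support hψ2
        have hm : AEStronglyMeasurable ψ (volume.restrict M.domain) :=
          hψ1.continuous.aestronglyMeasurable
        have hCae : ∀ᵐ x ∂(volume.restrict M.domain), ‖ψ x‖ ≤ C := Filter.Eventually.of_forall hC
        rw [← setIntegral_eq_integral_of_forall_compl_eq_zero (s := M.domain)]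
        · simp only [smul_eq_mul, mul_comm (ψ _), sub_mul]
          rw [integral_sub (hgi.mul_bdd hm hCae) (hGi.mul_bdd hm hCae)]
          linarith
        · intro x hx
          rw [image_eq_zero_of_notMem_tsupport fun h => hx (hWV (hψ3 h)), zero_smul]
      · intro t ht
        rw [setIntegral_fderiv_tetrahedron (M.indep _) (hψ1.mul (hv t ht))]
        refine Finset.sum_eq_zero fun a _ => ?_
        rw [faceInt_eq_zero (M.indep _) a, mul_zero]
        intro x hx
        rw [image_eq_zero_of_notMem_tsupport (f := ψ), zero_mul]
        exact fun h => (hψ3 h).2 (mem_iUnion.2 ⟨_, mem_iUnion.2 ⟨a, hx⟩⟩)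
  -- The faces are null sets, so the agreement on `W` now serves test functions whose support
  -- crosses faces.
  rw [hparts ψ hψ, neg_add_eq_zero]
  refine setIntegral_congr_ae M.isOpen_domain.measurableSet ?_
  have hnull : ∀ᵐ x, x ∉ ⋃ K, ⋃ a, face (M.vert K) a := by
    have : Countable κ := Finite.to_countable
    refine measure_eq_zero_iff_ae_notMem.1 ?_
    exact measure_iUnion_null fun K => measure_iUnion_null fun a => volume_face (M.indep K) a
  filter_upwards [hae, hnull] with x h1 h2 hx
  rw [sub_eq_zero.1 (h1 ⟨hx, h2⟩)]

end TetMesh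

/-! ### Base functions -/

section Basis

variable {p : ℕ} (B : PolytopalBasis p)

theorem contDiff_eval (q : MvPolynomial (Fin 3) ℝ) :
    ContDiff ℝ ∞ fun ξ : E3 => MvPolynomial.eval (fun i => ξ i) q := by
  induction q using MvPolynomial.induction_on with
  | C a => simpa using contDiff_const
  | add q q' h h' => simpa using h.add h'
  | mul_X q i h => simpa using h.mul (EuclideanSpace.proj i : E3 →L[ℝ] ℝ).contDiff

/-- The face opposite to `b` cannot contain a polytope that has `b` as a vertex. -/
theorem shape_eq_zero (d : Dof p) {b : Fin 4} (hb : b ∈ d.poly) {ξ : E3}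
    (hξ : ξ ∈ face refVert b) : B.shape d ξ = 0 := by
  refine B.vanish d (Finset.univ.erase b) (fun h => Finset.notMem_erase b _ (h hb)) ξ ?_
  rwa [show ((Finset.univ.erase b : Finset (Fin 4)) : Set (Fin 4)) = {c | c ≠ b} by ext; simp]

theorem contDiff_push_shape {P : Fin 4 → E3} (hP : AffineIndependent ℝ P) (d : Dof p) :
    ContDiff ℝ ∞ (push P (B.shape d)) :=
  contDiff_push hP (contDiff_eval _)

theorem push_shape_eq_zero {P : Fin 4 → E3} (hP : AffineIndependent ℝ P) (d : Dof p) {b : Fin 4}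
    (hb : b ∈ d.poly) {x : E3} (hx : x ∈ face P b) : push P (B.shape d) x = 0 := by
  rw [face, ← image_elemMap_convexHull] at hx
  obtain ⟨ξ, hξ, rfl⟩ := hx
  rw [push_elemMap hP]
  exact shape_eq_zero B d hb hξ

theorem piola_bdm (P : Fin 4 → E3) (d : Dof p) (r : Fin 3) (x : E3) :
    piola P (B.bdm d r) x =
      push P (B.shape d) x • ((jac P).det⁻¹ • jac P (template d.poly r)) :=
  piola_smul P _ _ x

theorem inner_faceNormal_piola {P : Fin 4 → E3} (hP : AffineIndependent ℝ P) (b : Fin 4)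
    (l : E3) : inner ℝ (faceNormal P b) ((jac P).det⁻¹ • jac P l) =
      inner ℝ (faceNormal refVert b) l := by
  rw [inner_smul_right, inner_faceNormal_jac, inv_mul_cancel_left₀ (det_jac_ne_zero hP)]

end Basis

/-- On every face other than `a`, a face type product has vanishing normal trace, because the
template vector is tangential or the scalar factor vanishes. -/
theorem IsFaceType.inner_eq_zero_or_mem {a : Fin 4} {S : Finset (Fin 4)} {r : Fin 3}
    (h : IsFaceType a S r) (hS : S.Nonempty) {b : Fin 4} (hba : b ≠ a) :
    inner ℝ (faceNormal refVert b) (template S r) = 0 ∨ b ∈ S :=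
  or_iff_not_imp_right.2 (h.inner_eq_zero hS hba)

theorem IsCellType.inner_eq_zero_or_mem {S : Finset (Fin 4)} {r : Fin 3}
    (h : IsCellType S r) (b : Fin 4) :
    inner ℝ (faceNormal refVert b) (template S r) = 0 ∨ b ∈ S :=
  or_iff_not_imp_right.2 (h.2 b)

theorem faceNormal_congr {P P' : Fin 4 → E3} {a a' : Fin 4}
    (h : (fun j => P (a.succAbove j)) = fun j => P' (a'.succAbove j)) :
    faceNormal P a = faceNormal P' a' := by
  have h' : ∀ j, P (a.succAbove j) = P' (a'.succAbove j) := congrFun h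
  simp only [faceNormal, h']

theorem image_ne_eq_range (P : Fin 4 → E3) (a : Fin 4) :
    P '' {b | b ≠ a} = range fun j => P (a.succAbove j) := by
  rw [range_comp' P a.succAbove, Fin.range_succAbove]
  rfl

/-- Gathers the contributions of all elements at one face into a single integral, in which their
signed traces can cancel. -/
theorem sum_mul_faceInt {ι : Type*} (T : Finset ι) (Q : Fin 3 → E3) (w : ι → ℝ) {v : ι → E3 → ℝ}
    {ψ : E3 → ℝ} (hψ : Continuous ψ) (hv : ∀ t ∈ T, Continuous (v t)) :
    ∑ t ∈ T, w t * faceInt Q (fun x => ψ x * v t x) =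
      faceInt Q (fun x => ψ x * ∑ t ∈ T, w t * v t x) := by
  simp only [faceInt, ← integral_const_mul]
  rw [← integral_finsetSum]
  · congr 1
    ext y
    rw [Finset.mul_sum]
    exact Finset.sum_congr rfl fun t _ => by ring
  · intro t ht
    exact integrableOn_tri (continuous_const.mul
      ((hψ.mul (hv t ht)).comp (continuous_faceParam Q)))

/-! ### Matching faces on the grid and cancellation of trace jumps -/

namespace TetMesh

variable {κ : Type*} (M : TetMesh κ)

/-- Two elements that share a face parametrize it in the same way. -/
theorem vert_succAbove_eq {K K' : κ} {a a' : Fin 4}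
    (h : M.vert K '' {b | b ≠ a} = M.vert K' '' {b | b ≠ a'}) :
    (fun j => M.vert K (a.succAbove j)) = fun j => M.vert K' (a'.succAbove j) := by
  rw [image_ne_eq_range, image_ne_eq_range] at h
  -- The vertex correspondence is strictly increasing by `ordered`, and a strictly increasing
  -- self-map of `Fin 3` is the identity.
  have h1 : ∀ j, ∃ i, M.vert K' (a'.succAbove i) = M.vert K (a.succAbove j) := fun j =>
    h.le (mem_range_self j)
  choose e he using h1
  have hmono : StrictMono e := fun i j hij => by
    have := M.ordered K K' _ _ _ _ (he i).symm (he j).symm ((Fin.strictMono_succAbove a) hij)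
    exact (Fin.strictMono_succAbove a').lt_iff_lt.1 this
  have hid : e = id := by
    refine (hmono.range_inj strictMono_id).1 ?_
    rw [range_id, (Finite.injective_iff_surjective.1 hmono.injective).range_eq]
  ext1 j
  rw [← he, hid, id]

/-- If an element has a face that contains a point in the relative interior of a face of the grid,
then the two faces coincide. -/
theorem image_ne_eq_of_mem_face {K K' : κ} {a b : Fin 4} {y : ℝ × ℝ} (hy : y ∈ tri)
    (hx : faceParam (fun j => M.vert K (a.succAbove j)) y ∈ face (M.vert K') b) :
    M.vert K' '' {c | c ≠ b} = M.vert K '' {c | c ≠ a} := by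
  have h1 : faceParam (fun j => M.vert K (a.succAbove j)) y ∈
      convexHull ℝ (range (M.vert K) ∩ range (M.vert K')) := by
    rw [← M.inter]
    exact ⟨convexHull_mono (image_subset_range _ _) (faceParam_mem_face (M.indep K) a hy),
      convexHull_mono (image_subset_range _ _) hx⟩
  rw [inter_comm, ← image_preimage_eq_inter_range, faceParam_eq_elemMap,
    elemMap_mem_convexHull (M.indep K)] at h1
  -- The point has positive weight at every vertex of its face, so each of them must be among the
  -- common vertices.
  have h2 : ∀ j, ∃ c, M.vert K' c = M.vert K (a.succAbove j) := fun j => by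
    by_contra hj
    exact (bary_faceParam_refVert_pos a.succAbove hy j).ne' (h1.2 _ hj)
  choose e he using h2
  -- If one of them were the vertex `b` of `K'`, the point would have positive `b`-coordinate and
  -- could not lie on the face opposite to `b`.
  have h3 : ∀ j, e j ≠ b := by
    rintro j rfl
    have : (fun j => M.vert K (a.succAbove j)) = fun j => elemMap (M.vert K') (refVert (e j)) := by
      ext1 i
      rw [elemMap_refVert, he]
    rw [this, ← elemMap_faceParam, elemMap_mem_face (M.indep K')] at hx
    exact (bary_faceParam_refVert_pos e hy j).ne' hx.2
  symm
  refine eq_of_subset_of_ncard_le ?_ ?_ (toFinite _)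
  · rw [image_ne_eq_range]
    rintro _ ⟨j, rfl⟩
    exact ⟨e j, h3 j, he j⟩
  · rw [ncard_image_of_injective _ (M.indep K).injective,
      ncard_image_of_injective _ (M.indep K').injective]
    have : ∀ c : Fin 4, {b : Fin 4 | b ≠ c}.ncard = 3 := by
      intro c
      rw [show {b : Fin 4 | b ≠ c} = range c.succAbove by ext; simp, ← image_univ,
        ncard_image_of_injective _ Fin.succAbove_right_injective, ncard_univ]
      simp
    rw [this, this]

variable {p : ℕ} [Fintype κ] (B : PolytopalBasis p)

open Classical in
/-- The elements and indices that contribute to a global scalar base function. -/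
def scalarIndices (s : Set E3) (m : ℕ) : Finset (κ × Dof p) :=
  Finset.univ.filter fun q => M.vert q.1 '' (q.2.poly : Set (Fin 4)) = s ∧ (q.2.2 : ℕ) = m

open Classical in
/-- The elements, faces, indices and template vectors that contribute to a global non-cell base
function. -/
def faceIndices (p : ℕ) (f s : Set E3) (m : ℕ) : Finset (κ × Fin 4 × Dof p × Fin 3) :=
  Finset.univ.filter fun t => M.vert t.1 '' {b | b ≠ t.2.1} = f ∧
    M.vert t.1 '' (t.2.2.1.poly : Set (Fin 4)) = s ∧ (t.2.2.1.2 : ℕ) = m ∧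
      IsFaceType t.2.1 t.2.2.1.poly t.2.2.2

theorem globalScalar_eq_sum (s : Set E3) (m : ℕ) :
    M.globalScalar B s m = ∑ q ∈ M.scalarIndices s m,
      M.onElem q.1 (push (M.vert q.1) (B.shape q.2)) := by
  rw [scalarIndices, Finset.sum_filter, Fintype.sum_prod_type]
  rfl

theorem globalFace_eq_sum (f s : Set E3) (m : ℕ) :
    M.globalFace B f s m = ∑ t ∈ M.faceIndices p f s m,
      M.onElem t.1 (fun x => push (M.vert t.1) (B.shape t.2.2.1) x •
        ((jac (M.vert t.1)).det⁻¹ • jac (M.vert t.1) (template t.2.2.1.poly t.2.2.2))) := by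
  rw [faceIndices, Finset.sum_filter, Fintype.sum_prod_type]
  simp only [Fintype.sum_prod_type, globalFace]
  refine Finset.sum_congr rfl fun K _ => Finset.sum_congr rfl fun a _ =>
    Finset.sum_congr rfl fun d _ => Finset.sum_congr rfl fun r _ => ?_
  rw [show piola (M.vert K) (B.bdm d r) = _ from funext (piola_bdm B (M.vert K) d r)]

/-- Reorganizing a sum over all faces of the elements of a polytope `s`, when only the face `f`
contributes. -/
theorem sum_faceIndices {f s : Set E3} {m : ℕ} (hsf : s ⊆ f) (X : κ → Dof p → Fin 4 → ℝ)
    (hX : ∀ K d a, M.vert K '' {b | b ≠ a} ≠ f → X K d a = 0) :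
    ∑ q ∈ M.scalarIndices s m, ∑ a, X q.1 q.2 a =
      ∑ t ∈ M.faceIndices p f s m, X t.1 t.2.2.1 t.2.1 := by
  classical
  rw [scalarIndices, faceIndices, Finset.sum_filter, Finset.sum_filter]
  simp only [Fintype.sum_prod_type]
  refine Finset.sum_congr rfl fun K _ => ?_
  rw [Finset.sum_comm]
  refine Finset.sum_congr rfl fun d _ => ?_
  by_cases hd : M.vert K '' (d.poly : Set (Fin 4)) = s ∧ (d.2 : ℕ) = m
  · rw [if_pos hd]
    refine Finset.sum_congr rfl fun a _ => ?_
    by_cases ha : M.vert K '' {b | b ≠ a} = f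
    · have had : a ∉ d.poly := by
        intro h
        have h1 : M.vert K a ∈ M.vert K '' {b | b ≠ a} := by
          rw [ha]
          exact hsf (hd.1 ▸ mem_image_of_mem _ h)
        obtain ⟨b, hb, hba⟩ := h1
        exact hb ((M.indep K).injective hba)
      -- The face contains the polytope, so a single `r` survives and the sum over template vectors
      -- collapses.
      obtain ⟨r, hr⟩ := exists_isFaceType_iff d.1.2 had
      have hr' : ∀ r', IsFaceType a d.poly r' ↔ r' = r := hr
      simp [ha, hd, hr']
    · rw [hX K d a ha]
      simp
  · rw [if_neg hd]
    symm
    refine Finset.sum_eq_zero fun a _ => Finset.sum_eq_zero fun r _ => if_neg ?_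
    exact fun h => hd ⟨h.2.1, h.2.2.1⟩

/-- The jump of the traces of a global scalar base function across a face `f`. -/
def traceJump (f s : Set E3) (m : ℕ) (x : E3) : ℝ :=
  ∑ t ∈ M.faceIndices p f s m, ((SignType.sign (jac (M.vert t.1)).det : ℝ) * faceSign t.2.1) *
    push (M.vert t.1) (B.shape t.2.2.1) x

theorem continuous_traceJump (f s : Set E3) (m : ℕ) : Continuous (M.traceJump B f s m) :=
  continuous_finsetSum _ fun t _ =>
    continuous_const.mul (contDiff_push_shape B (M.indep t.1) t.2.2.1).continuous

theorem mem_faceIndices {f s : Set E3} {m : ℕ} {t : κ × Fin 4 × Dof p × Fin 3} :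
    t ∈ M.faceIndices p f s m ↔ M.vert t.1 '' {b | b ≠ t.2.1} = f ∧
      M.vert t.1 '' (t.2.2.1.poly : Set (Fin 4)) = s ∧ (t.2.2.1.2 : ℕ) = m ∧
        IsFaceType t.2.1 t.2.2.1.poly t.2.2.2 := by
  simp [faceIndices]

theorem succAbove_eq_of_mem_faceIndices {f s : Set E3} {m : ℕ} {t t₀ : κ × Fin 4 × Dof p × Fin 3}
    (ht : t ∈ M.faceIndices p f s m) (ht₀ : t₀ ∈ M.faceIndices p f s m) :
    (fun j => M.vert t.1 (t.2.1.succAbove j)) = fun j => M.vert t₀.1 (t₀.2.1.succAbove j) :=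
  M.vert_succAbove_eq ((M.mem_faceIndices.1 ht).1.trans (M.mem_faceIndices.1 ht₀).1.symm)

/-- The weak form of the trace continuity across a face that is provided by `H¹`-conformity. -/
theorem faceInt_mul_traceJump_eq_zero (hB : (M.scalarSpace B : Set (E3 → ℝ)) ⊆ H1 M.domain)
    {f s : Set E3} {m : ℕ} {t₀ : κ × Fin 4 × Dof p × Fin 3} (ht₀ : t₀ ∈ M.faceIndices p f s m)
    {ψ : E3 → ℝ} (hψ : IsTestFunction M.domain ψ)
    (hψf : ∀ K a, M.vert K '' {b | b ≠ a} ≠ f → ∀ x ∈ face (M.vert K) a, ψ x = 0) :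
    faceInt (fun j => M.vert t₀.1 (t₀.2.1.succAbove j)) (fun x => ψ x * M.traceJump B f s m x) =
      0 := by
  have hmem := M.mem_faceIndices.1 ht₀
  have hH1 : M.globalScalar B s m ∈ H1 M.domain := hB (Submodule.subset_span ⟨s, m, rfl⟩)
  rw [globalScalar_eq_sum] at hH1
  -- A partial derivative detects the jump only through this component of the face normal. The
  -- normal is nonzero, since otherwise the template vector at `t₀` would have zero reference trace.
  obtain ⟨i, hi⟩ : ∃ i : Fin 3, faceNormal (M.vert t₀.1) t₀.2.1 i ≠ 0 := by
    by_contra! h0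
    have h1 : faceNormal (M.vert t₀.1) t₀.2.1 = 0 := by
      ext i
      exact h0 i
    have h2 := inner_faceNormal_jac (M.vert t₀.1) t₀.2.1 (template t₀.2.2.1.poly t₀.2.2.2)
    rw [h1, inner_zero_left] at h2
    exact mul_ne_zero (det_jac_ne_zero (M.indep t₀.1)) hmem.2.2.2.2 h2.symm
  have hsum := M.sum_setIntegral_fderiv_eq_zero _ _
    (fun q _ => contDiff_push_shape B (M.indep q.1) q.2) hH1 hψ i
  simp only [fun q : κ × Dof p => setIntegral_fderiv_tetrahedron (M.indep q.1)
    (hψ.1.mul (contDiff_push_shape B (M.indep q.1) q.2)) (EuclideanSpace.single i 1)] at hsum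
  have hsf : s ⊆ f := by
    rw [← hmem.1, ← hmem.2.1]
    exact image_mono fun b hb h => hmem.2.2.2.1 (h ▸ hb)
  rw [M.sum_faceIndices hsf (fun K d a => (SignType.sign (jac (M.vert K)).det : ℝ) * faceSign a *
    inner ℝ (faceNormal (M.vert K) a) (EuclideanSpace.single i 1) *
      faceInt (fun j => M.vert K (a.succAbove j))
        (fun x => ψ x * push (M.vert K) (B.shape d) x))] at hsum
  · have hterm : ∀ t ∈ M.faceIndices p f s m,
        (SignType.sign (jac (M.vert t.1)).det : ℝ) * faceSign t.2.1 *
          inner ℝ (faceNormal (M.vert t.1) t.2.1) (EuclideanSpace.single i 1) *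
          faceInt (fun j => M.vert t.1 (t.2.1.succAbove j))
            (fun x => ψ x * push (M.vert t.1) (B.shape t.2.2.1) x) =
        faceNormal (M.vert t₀.1) t₀.2.1 i *
          (((SignType.sign (jac (M.vert t.1)).det : ℝ) * faceSign t.2.1) *
          faceInt (fun j => M.vert t₀.1 (t₀.2.1.succAbove j))
            (fun x => ψ x * push (M.vert t.1) (B.shape t.2.2.1) x)) := by
      intro t ht
      have h := M.succAbove_eq_of_mem_faceIndices ht ht₀
      rw [faceNormal_congr h, h, EuclideanSpace.inner_single_right]
      simp
      ring
    rw [Finset.sum_congr rfl hterm, ← Finset.mul_sum, sum_mul_faceInt _ _ _ hψ.1.continuous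
      fun t _ => (contDiff_push_shape B (M.indep t.1) t.2.2.1).continuous] at hsum
    exact (mul_eq_zero.1 hsum).resolve_left hi
  · intro K d a ha
    rw [faceInt_eq_zero (M.indep K) a, mul_zero]
    intro x hx
    rw [hψf K a ha x hx, zero_mul]

/-- `H¹`-conformity makes the traces continuous across the faces inside the domain. -/
theorem traceJump_eq_zero (hB : (M.scalarSpace B : Set (E3 → ℝ)) ⊆ H1 M.domain)
    {f s : Set E3} {m : ℕ} {t₀ : κ × Fin 4 × Dof p × Fin 3} (ht₀ : t₀ ∈ M.faceIndices p f s m)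
    {y : ℝ × ℝ} (hy : y ∈ tri)
    (hx : faceParam (fun j => M.vert t₀.1 (t₀.2.1.succAbove j)) y ∈ M.domain) :
    M.traceJump B f s m (faceParam (fun j => M.vert t₀.1 (t₀.2.1.succAbove j)) y) = 0 := by
  set F := faceParam (fun j => M.vert t₀.1 (t₀.2.1.succAbove j))
  set j := M.traceJump B f s m
  have hjc : Continuous j := M.continuous_traceJump B f s m
  have hFc : Continuous F := continuous_faceParam _
  by_contra hne
  -- All faces other than `f`; a relative interior point of `f` avoids them, so a small bump sees
  -- only `f`.
  let Z : Set E3 := ⋃ K, ⋃ a, ⋃ (_ : M.vert K '' {b | b ≠ a} ≠ f), face (M.vert K) a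
  have hZ : IsClosed Z := isClosed_iUnion_of_finite fun K => isClosed_iUnion_of_finite fun a =>
    isClosed_iUnion_of_finite fun _ => (isCompact_face _ a).isClosed
  have hxZ : F y ∉ Z := by
    simp only [Z, mem_iUnion, not_exists]
    intro K a ha hmem
    exact ha ((M.image_ne_eq_of_mem_face hy hmem).trans (M.mem_faceIndices.1 ht₀).1)
  -- Here the jump keeps the sign it has at `F y`, so the bump integral cannot cancel.
  let N : Set E3 := (M.domain \ Z) ∩ {z | 0 < j z * j (F y)}
  have hN : IsOpen N := (M.isOpen_domain.sdiff hZ).inter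
    (isOpen_lt continuous_const (hjc.mul continuous_const))
  have hyN : F y ∈ N := ⟨⟨hx, hxZ⟩, mul_self_pos.2 hne⟩
  obtain ⟨r, hr, hrN⟩ := Metric.nhds_basis_closedBall.mem_iff.1 (hN.mem_nhds hyN)
  let ψ : ContDiffBump (F y) := ⟨r / 2, r, by linarith, by linarith⟩
  have hψN : tsupport ψ ⊆ N := by
    rw [ψ.tsupport_eq]
    exact hrN
  have htest : IsTestFunction M.domain ψ :=
    ⟨ψ.contDiff, ψ.hasCompactSupport, hψN.trans (inter_subset_left.trans sdiff_subset)⟩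
  have h0 := M.faceInt_mul_traceJump_eq_zero B hB ht₀ htest (by
    intro K a ha x hxa
    refine image_eq_zero_of_notMem_tsupport fun h => (hψN h).1.2 ?_
    exact mem_iUnion.2 ⟨K, mem_iUnion.2 ⟨a, mem_iUnion.2 ⟨ha, hxa⟩⟩⟩)
  -- The constant factor `j (F y)` makes the integrand nonnegative whichever sign the jump has.
  have hcont : Continuous fun z => ψ (F z) * j (F z) * j (F y) :=
    ((ψ.continuous.comp hFc).mul (hjc.comp hFc)).mul continuous_const
  have hpos : 0 < ∫ z in tri, ψ (F z) * j (F z) * j (F y) := by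
    rw [setIntegral_pos_iff_support_of_nonneg_ae _ (integrableOn_tri hcont)]
    · refine ((hcont.isOpen_support).inter isOpen_tri).measure_pos volume ⟨y, ?_, hy⟩
      rw [Function.mem_support, ψ.one_of_mem_closedBall (Metric.mem_closedBall_self (by
        exact (half_pos hr).le)), one_mul]
      exact mul_ne_zero hne hne
    · refine Filter.Eventually.of_forall fun z => ?_
      by_cases hz : F z ∈ tsupport ψ
      · exact (mul_nonneg ψ.nonneg (hψN hz).2.le).trans_eq (mul_assoc _ _ _).symm
      · simp [image_eq_zero_of_notMem_tsupport hz]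
  rw [integral_mul_const] at hpos
  rw [faceInt] at h0
  rw [h0, zero_mul] at hpos
  exact lt_irrefl _ hpos

/-- The boundary contribution of a mapped non-cell function: only its own face contributes. -/
theorem setIntegral_fderiv_of_isFaceType {P : Fin 4 → E3} (hP : AffineIndependent ℝ P) {a : Fin 4}
    {d : Dof p} {r : Fin 3} (h : IsFaceType a d.poly r) {ψ : E3 → ℝ} (hψ : ContDiff ℝ ∞ ψ) :
    ∫ x in interior (tetrahedron P), fderiv ℝ (fun x => ψ x * push P (B.shape d) x) x
        ((jac P).det⁻¹ • jac P (template d.poly r)) =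
      (SignType.sign (jac P).det : ℝ) * faceSign a *
        faceInt (fun j => P (a.succAbove j)) (fun x => ψ x * push P (B.shape d) x) := by
  rw [setIntegral_fderiv_tetrahedron hP (hψ.mul (contDiff_push_shape B hP d)),
    Finset.sum_eq_single a]
  · rw [inner_faceNormal_piola hP, h.inner_eq_one d.1.2, mul_one]
  · intro b _ hb
    rw [inner_faceNormal_piola hP]
    rcases h.inner_eq_zero_or_mem d.1.2 hb with h0 | hmem
    · rw [h0, mul_zero, zero_mul]
    · rw [faceInt_eq_zero hP b, mul_zero]
      intro x hx
      rw [push_shape_eq_zero B hP d hmem hx, mul_zero]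
  · simp

/-- The elementwise boundary terms add up to the integral of `ψ` times the jump over one common
face, and at each of its points one of these two factors vanishes. -/
theorem globalFace_mem_Hdiv (hB : (M.scalarSpace B : Set (E3 → ℝ)) ⊆ H1 M.domain)
    (f s : Set E3) (m : ℕ) : M.globalFace B f s m ∈ Hdiv M.domain := by
  rw [globalFace_eq_sum]
  refine M.sum_onElem_mem_Hdiv _ _ _
    (fun t _ => contDiff_push_shape B (M.indep t.1) t.2.2.1) fun ψ hψ => ?_
  rcases (M.faceIndices p f s m).eq_empty_or_nonempty with hT | ⟨t₀, ht₀⟩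
  · rw [hT, Finset.sum_empty]
  have hterm : ∀ t ∈ M.faceIndices p f s m, _ = _ := fun t ht =>
    setIntegral_fderiv_of_isFaceType B (M.indep t.1) (M.mem_faceIndices.1 ht).2.2.2 hψ.1
  rw [Finset.sum_congr rfl hterm, Finset.sum_congr rfl fun t ht => by
    rw [M.succAbove_eq_of_mem_faceIndices ht ht₀], sum_mul_faceInt _ _ _ hψ.1.continuous
      fun t _ => (contDiff_push_shape B (M.indep t.1) t.2.2.1).continuous]
  refine setIntegral_eq_zero_of_forall_eq_zero fun y hy => ?_
  -- Boundary faces need no separate treatment: outside the open domain the test function is zero.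
  by_cases hx : faceParam (fun j => M.vert t₀.1 (t₀.2.1.succAbove j)) y ∈ M.domain
  · exact mul_eq_zero_of_right _ (M.traceJump_eq_zero B hB ht₀ hy hx)
  · exact mul_eq_zero_of_left (image_eq_zero_of_notMem_tsupport fun h => hx (hψ.2.2 h)) _

end TetMesh

/-- Every face term vanishes already on the single element, by the direction or by the scalar
factor, so the `H¹` hypothesis plays no role. -/
theorem TetMesh.globalCell_mem_Hdiv {κ : Type*} (M : TetMesh κ) {p : ℕ} (B : PolytopalBasis p)
    (K : κ) {d : Dof p} {r : Fin 3} (h : IsCellType d.poly r) :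
    M.globalCell B K d r ∈ Hdiv M.domain := by
  -- Written as a sum over `Unit` to fit the criterion for piecewise fields.
  have heq : M.globalCell B K d r = ∑ _t ∈ (Finset.univ : Finset Unit),
      M.onElem K (fun x => push (M.vert K) (B.shape d) x •
        ((jac (M.vert K)).det⁻¹ • jac (M.vert K) (template d.poly r))) := by
    rw [Finset.univ_unique, Finset.sum_singleton, globalCell,
      show piola (M.vert K) (B.bdm d r) = _ from funext (piola_bdm B (M.vert K) d r)]
  rw [heq]
  refine M.sum_onElem_mem_Hdiv _ (fun _ => K) (v := fun _ => push (M.vert K) (B.shape d))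
    (fun _ => (jac (M.vert K)).det⁻¹ • jac (M.vert K) (template d.poly r))
    (fun _ _ => contDiff_push_shape B (M.indep K) d) fun ψ hψ => ?_
  refine Finset.sum_eq_zero fun _ _ => ?_
  rw [setIntegral_fderiv_tetrahedron (M.indep K) (hψ.1.mul (contDiff_push_shape B (M.indep K) d))]
  refine Finset.sum_eq_zero fun b _ => ?_
  rw [inner_faceNormal_piola (M.indep K)]
  rcases h.inner_eq_zero_or_mem b with h0 | hmem
  · rw [h0, mul_zero, zero_mul]
  · rw [faceInt_eq_zero (M.indep K) b, mul_zero]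
    intro x hx
    rw [push_shape_eq_zero B (M.indep K) d hmem hx, mul_zero]

/-! ### `H(div)` is a vector space -/

section HdivSubmodule

variable {V : Set E3}

/-- Splitting the integral of a sum of fields requires each pairing with a test gradient to be
integrable; this is Hölder's inequality. -/
theorem integrable_fderiv_apply {u : E3 → E3} (hu : MemLp u 2 (volume.restrict V)) {ψ : E3 → ℝ}
    (hψ : IsTestFunction V ψ) :
    Integrable (fun x => fderiv ℝ ψ x (u x)) (volume.restrict V) := by
  have h1 : MemLp (fderiv ℝ ψ) 2 (volume.restrict V) :=
    (hψ.1.continuous_fderiv (by simp)).memLp_of_hasCompactSupport (hψ.2.1.fderiv ℝ)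
  have h2 := h1.norm.integrable_mul hu.norm
  refine h2.mono' ?_ (Filter.Eventually.of_forall fun x => (fderiv ℝ ψ x).le_opNorm (u x))
  exact (ContinuousLinearMap.apply ℝ ℝ : E3 →L[ℝ] _).aestronglyMeasurable_comp₂
    hu.aestronglyMeasurable h1.aestronglyMeasurable

theorem integrable_mul_test {g : E3 → ℝ} (hg : MemLp g 2 (volume.restrict V)) {ψ : E3 → ℝ}
    (hψ : IsTestFunction V ψ) : Integrable (fun x => g x * ψ x) (volume.restrict V) :=
  have h : MemLp ψ 2 (volume.restrict V) := hψ.1.continuous.memLp_of_hasCompactSupport hψ.2.1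
  hg.integrable_mul h

theorem zero_mem_Hdiv : (0 : E3 → E3) ∈ Hdiv V :=
  ⟨MemLp.zero, 0, MemLp.zero, fun ψ _ => by simp⟩

theorem add_mem_Hdiv {u u' : E3 → E3} (hu : u ∈ Hdiv V) (hu' : u' ∈ Hdiv V) :
    u + u' ∈ Hdiv V := by
  obtain ⟨h1, g, hg, h2⟩ := hu
  obtain ⟨h1', g', hg', h2'⟩ := hu'
  refine ⟨h1.add h1', g + g', hg.add hg', fun ψ hψ => ?_⟩
  simp only [Pi.add_apply, map_add, add_mul]
  rw [integral_add (integrable_fderiv_apply h1 hψ) (integrable_fderiv_apply h1' hψ),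
    integral_add (integrable_mul_test hg hψ) (integrable_mul_test hg' hψ), h2 ψ hψ, h2' ψ hψ]
  ring

theorem smul_mem_Hdiv (c : ℝ) {u : E3 → E3} (hu : u ∈ Hdiv V) : c • u ∈ Hdiv V := by
  obtain ⟨h1, g, hg, h2⟩ := hu
  refine ⟨h1.const_smul c, c • g, hg.const_smul c, fun ψ hψ => ?_⟩
  simp only [Pi.smul_apply, map_smul, smul_eq_mul, mul_assoc]
  rw [integral_const_mul, integral_const_mul, h2 ψ hψ, mul_neg]

end HdivSubmodule

/-! ### Assembly of the conformity and trace statements -/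

theorem TetMesh.bdmSpace_subset_Hdiv {κ : Type*} (M : TetMesh κ) {p : ℕ} [Fintype κ]
    (B : PolytopalBasis p) (hB : (M.scalarSpace B : Set (E3 → ℝ)) ⊆ H1 M.domain) :
    (M.bdmSpace B : Set (E3 → E3)) ⊆ Hdiv M.domain := by
  intro u hu
  refine Submodule.span_induction ?_ zero_mem_Hdiv (fun _ _ _ _ => add_mem_Hdiv)
    (fun c _ _ => smul_mem_Hdiv c) hu
  rintro _ (⟨f, s, m, rfl⟩ | ⟨K, d, r, h, rfl⟩)
  · exact M.globalFace_mem_Hdiv B hB f s m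
  · exact M.globalCell_mem_Hdiv B K h

end PolytopalBDM

end

open PolytopalBDM in
theorem mainTheorem12 {p : ℕ} (hp : 1 ≤ p) (B : PolytopalBasis p) :
    -- H(div)-conformity on every grid on which the scalar basis is H¹-conforming
    (∀ (κ : Type) [Fintype κ] (M : TetMesh κ),
      (M.scalarSpace B : Set (E3 → ℝ)) ⊆ H1 M.domain →
      (M.bdmSpace B : Set (E3 → E3)) ⊆ Hdiv M.domain) ∧
    -- normal projections of the non-cell functions on the reference tetrahedron
    (∀ (a : Fin 4) (d : Dof p) (r : Fin 3), IsFaceType a d.poly r →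
      (∀ ξ ∈ face refVert a, inner ℝ (faceNormal refVert a) (B.bdm d r ξ) = B.shape d ξ) ∧
      (∀ b, b ≠ a → ∀ ξ ∈ face refVert b,
        inner ℝ (faceNormal refVert b) (B.bdm d r ξ) = 0)) ∧
    -- normal projections of the cell functions on the reference tetrahedron
    (∀ (d : Dof p) (r : Fin 3), IsCellType d.poly r →
      ∀ b, ∀ ξ ∈ face refVert b, inner ℝ (faceNormal refVert b) (B.bdm d r ξ) = 0) ∧
    -- the same for the Piola transformed functions on a physical tetrahedron
    (∀ P : Fin 4 → E3, AffineIndependent ℝ P →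
      (∀ (a : Fin 4) (d : Dof p) (r : Fin 3), IsFaceType a d.poly r →
        (∀ x ∈ face P a,
          inner ℝ (faceNormal P a) (piola P (B.bdm d r) x) = push P (B.shape d) x) ∧
        (∀ b, b ≠ a → ∀ x ∈ face P b,
          inner ℝ (faceNormal P b) (piola P (B.bdm d r) x) = 0)) ∧
      (∀ (d : Dof p) (r : Fin 3), IsCellType d.poly r →
        ∀ b, ∀ x ∈ face P b, inner ℝ (faceNormal P b) (piola P (B.bdm d r) x) = 0)) := by
  refine ⟨fun κ _ M hB => M.bdmSpace_subset_Hdiv B hB, fun a d r h => ⟨?_, ?_⟩,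
    fun d r h b ξ hξ => ?_, fun P hP => ⟨fun a d r h => ⟨?_, ?_⟩, fun d r h b x hx => ?_⟩⟩
  · intro ξ _
    rw [PolytopalBasis.bdm, inner_smul_right, h.inner_eq_one d.1.2, mul_one]
  · intro b hb ξ hξ
    rw [PolytopalBasis.bdm, inner_smul_right]
    rcases h.inner_eq_zero_or_mem d.1.2 hb with h0 | hmem
    · rw [h0, mul_zero]
    · rw [shape_eq_zero B d hmem hξ, zero_mul]
  · rw [PolytopalBasis.bdm, inner_smul_right]
    rcases h.inner_eq_zero_or_mem b with h0 | hmem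
    · rw [h0, mul_zero]
    · rw [shape_eq_zero B d hmem hξ, zero_mul]
  · intro x _
    rw [piola_bdm B P, inner_smul_right, inner_faceNormal_piola hP, h.inner_eq_one d.1.2,
      mul_one]
  · intro b hb x hx
    rw [piola_bdm B P, inner_smul_right, inner_faceNormal_piola hP]
    rcases h.inner_eq_zero_or_mem d.1.2 hb with h0 | hmem
    · rw [h0, mul_zero]
    · rw [push_shape_eq_zero B hP d hmem hx, zero_mul]
  · rw [piola_bdm B P, inner_smul_right, inner_faceNormal_piola hP]
    rcases h.inner_eq_zero_or_mem b with h0 | hmem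
    · rw [h0, mul_zero]
    · rw [push_shape_eq_zero B hP d hmem hx, zero_mul]
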